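/- Notation. Let $B(x)=B_0+B_1(x)$, $x\in\mathbb R^2$, where $B_0>0$ is a constant and $B_1:\mathbb R^2\to\mathbb R$ is differentiable with bounded gradient, and let $V:\mathbb R^2\to\mathbb R$ be bounded and differentiable with bounded gradient. Let $A:\mathbb R^2\to\mathbb R^2$ be any differentiable vector potential of $B$, i.e. $\partial_1A_2-\partial_2A_1=B$, and let $H(B)=(p-A)^2+V$, $p=-i\nabla$, be the magnetic Schrödinger operator on $L^2(\mathbb R^2)$, realised as the Friedrichs extension, that is, as the self-adjoint operator associated with the closure of the quadratic form $\varphi\mapsto\|(p-A)\varphi\|^2+\langle\varphi,V\varphi\rangle$, $\varphi\in C_c^\infty(\mathbb R^2)$. For $n\in\mathbb N=\{0,1,2,\dots\}$ put $$e_{n,\min}[B]=\inf_{x\in\mathbb R^2}\big[(2n+1)B(x)+V(x)\big],\qquad e_{n,\max}[B]=\sup_{x\in\mathbb R^2}\big[(2n+1)B(x)+V(x)\big],$$ $$\hat K_2=\|\nabla B_1\|_\infty+\|\nabla V\|_\infty,\qquad \hat K_3=\|\nabla B_1\|_\infty^2 .$$ Theorem. Let $C_1>0$. There are constants $C_{\mathrm{ext},n}\ge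 0$, $n\in\mathbb N$, depending only on $n$ and $C_1$, such that the following holds for all $B_0,B_1,V,A$ as above with $$C_1^{-1}B_0\le B(x)\le C_1B_0\qquad\text{for all }x\in\mathbb R^2 .$$ For every $n\in\mathbb N$ the interval $\big(\hat I_n^+[B],\hat I_{n+1}^-[B]\big)$ with $$\hat I_n^+[B]=e_{n,\max}[B]+C_{\mathrm{ext},n}\big[\hat K_2B_0^{-1/2}+\hat K_3B_0^{-2}\big],$$ $$\hat I_{n+1}^-[B]=e_{n+1,\min}[B]-C_{\mathrm{ext},n+1}\big[\hat K_2B_0^{-1/2}+\hat K_3B_0^{-2}\big]$$ is contained in the resolvent set of $H(B)$. -/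

import Mathlib

open MeasureTheory Set TopologicalSpace
open scoped ContDiff BoundedContinuousFunction Distributions LinearPMap

namespace MagneticSchrodinger

noncomputable section

/-- The Euclidean plane `ℝ²` (coordinates are indexed by `0, 1`). -/
abbrev Plane : Type := EuclideanSpace ℝ (Fin 2)

/-- `L²(ℝ²; ℂ)`. -/
abbrev L2 : Type := Lp ℂ 2 (volume : Measure Plane)

/-- `L²(ℝ²; ℂ²)`. -/
abbrev L2Vec : Type := Lp (EuclideanSpace ℂ (Fin 2)) 2 (volume : Measure Plane)

/-- Complex-valued test functions `C_c^∞(ℝ²)`. -/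
abbrev Test : Type := 𝓓((⊤ : Opens Plane), ℂ)

/-- The standard basis vectors of the plane. -/
abbrev e (j : Fin 2) : Plane := EuclideanSpace.single j 1

/-- `A` is a (differentiable) vector potential of the magnetic field `B`:
`∇ × A = ∂₁ A₂ - ∂₂ A₁ = B`. -/
def IsVectorPotential (A : Plane → Plane) (B : Plane → ℝ) : Prop :=
  Differentiable ℝ A ∧ ∀ x, fderiv ℝ A x (e 0) 1 - fderiv ℝ A x (e 1) 0 = B x

/-- `(p - A) φ = -i ∇φ - A φ` for a test function `φ`, as a `ℂ²`-valued function. -/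
def momentumFun (A : C(Plane, Plane)) (φ : Test) (x : Plane) : EuclideanSpace ℂ (Fin 2) :=
  WithLp.toLp 2 fun j => -Complex.I * fderiv ℝ φ x (e j) - (A x j : ℂ) * φ x

theorem memLp_test (φ : Test) : MemLp φ 2 (volume : Measure Plane) :=
  φ.continuous.memLp_of_hasCompactSupport φ.hasCompactSupport

theorem memLp_momentumFun (A : C(Plane, Plane)) (φ : Test) :
    MemLp (momentumFun A φ) 2 (volume : Measure Plane) := by
  have hc : Continuous (fderiv ℝ (φ : Plane → ℂ)) := φ.contDiff.continuous_fderiv (by simp)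
  apply Continuous.memLp_of_hasCompactSupport
  · apply (PiLp.continuous_toLp 2 _).comp
    apply continuous_pi
    intro j
    have hA : Continuous fun x => A x j :=
      (EuclideanSpace.proj (𝕜 := ℝ) j).continuous.comp A.continuous
    exact (continuous_const.mul (hc.clm_apply continuous_const)).sub
      ((Complex.continuous_ofReal.comp hA).mul φ.continuous)
  · apply HasCompactSupport.intro φ.hasCompactSupport
    intro x hx
    have h0 : φ x = 0 := image_eq_zero_of_notMem_tsupport hx
    have h1 : fderiv ℝ (φ : Plane → ℂ) x = 0 := fderiv_of_notMem_tsupport ℝ hx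
    ext j
    simp [momentumFun, h0, h1]

/-- The inclusion `C_c^∞(ℝ²) → L²(ℝ²)`. -/
def testToL2 : Test →ₗ[ℂ] L2 where
  toFun φ := (memLp_test φ).toLp φ
  map_add' _ _ := rfl
  map_smul' _ _ := rfl

theorem testToL2_injective : Function.Injective testToL2 := by
  intro φ ψ h
  have h' : (φ : Plane → ℂ) =ᵐ[volume] ψ := 
    (MemLp.toLp_eq_toLp_iff (memLp_test φ) (memLp_test ψ)).1 h
  exact DFunLike.coe_injective ((φ.continuous.ae_eq_iff_eq volume ψ.continuous).1 h')

/-- `φ ↦ (p - A) φ` as a linear map `C_c^∞(ℝ²) → L²(ℝ²; ℂ²)`. -/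
def momentumTest (A : C(Plane, Plane)) : Test →ₗ[ℂ] L2Vec where
  toFun φ := (memLp_momentumFun A φ).toLp (momentumFun A φ)
  map_add' φ ψ := by
    rw [← MemLp.toLp_add]
    congr 1
    funext x
    ext j
    have : fderiv ℝ ((φ + ψ : Test) : Plane → ℂ) x = fderiv ℝ φ x + fderiv ℝ ψ x :=
      fderiv_add (φ.contDiff.differentiable (by simp) x) (ψ.contDiff.differentiable (by simp) x)
    simp only [momentumFun, this]
    simp [momentumFun]
    ring
  map_smul' c φ := by
    rw [RingHom.id_apply, ← MemLp.toLp_const_smul]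
    congr 1
    funext x
    ext j
    have : fderiv ℝ ((c • φ : Test) : Plane → ℂ) x = c • fderiv ℝ φ x :=
      fderiv_const_smul (φ.contDiff.differentiable (by simp) x) c
    simp only [momentumFun, this]
    simp [momentumFun]
    ring

/-- The operator `p - A` from `L²(ℝ²)` to `L²(ℝ²; ℂ²)` with domain `C_c^∞(ℝ²)`. -/
def momentum (A : C(Plane, Plane)) : L2 →ₗ.[ℂ] L2Vec where
  domain := LinearMap.range testToL2
  toFun := momentumTest A ∘ₗ (LinearEquiv.ofInjective testToL2 testToL2_injective).symm

/-- The operator `D* D̄` of a densely defined closable operator `D`: its domain consists of the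
`ψ` in the domain of the closure `D̄` with `D̄ ψ` in the domain of the adjoint `D*`. It is the
self-adjoint operator associated with the closure of the quadratic form `φ ↦ ‖D φ‖²`. -/
def adjointCompClosure (D : L2 →ₗ.[ℂ] L2Vec) : L2 →ₗ.[ℂ] L2 :=
  D†.comp
    (D.closure.domRestrict ((D†.domain.comap D.closure.toFun).map D.closure.domain.subtype))
    (by
      rintro ⟨x, hx, hx'⟩
      obtain ⟨y, hy, rfl⟩ := hx
      exact hy)

theorem memLp_potential (V : Plane →ᵇ ℝ) (ψ : L2) :
    MemLp (fun x => (V x : ℂ) * ψ x) 2 (volume : Measure Plane) := by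
  refine (Lp.memLp ψ).of_le_mul (c := ‖V‖)
    ((Complex.continuous_ofReal.comp V.continuous).aestronglyMeasurable.mul
      (Lp.aestronglyMeasurable ψ)) ?_
  filter_upwards with x
  rw [norm_mul, Complex.norm_real]
  exact mul_le_mul_of_nonneg_right (V.norm_coe_le_norm x) (norm_nonneg _)

/-- Multiplication by a bounded potential `V` on `L²(ℝ²)`. -/
def potential (V : Plane →ᵇ ℝ) : L2 →ₗ[ℂ] L2 where
  toFun ψ := (memLp_potential V ψ).toLp _
  map_add' ψ χ := by
    rw [← MemLp.toLp_add]
    apply MemLp.toLp_congr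
    filter_upwards [Lp.coeFn_add ψ χ] with x hx
    rw [hx]
    simp [mul_add]
  map_smul' c ψ := by
    rw [RingHom.id_apply, ← MemLp.toLp_const_smul]
    apply MemLp.toLp_congr
    filter_upwards [Lp.coeFn_smul c ψ] with x hx
    rw [hx]
    simp [mul_left_comm]

/-- The magnetic Schrödinger operator `H(A) = (p - A)² + V` on `L²(ℝ²)`, realised as the Friedrichs
extension, i.e. as the self-adjoint operator associated with the closure of the quadratic form
`φ ↦ ‖(p - A) φ‖² + ⟨φ, V φ⟩`, `φ ∈ C_c^∞(ℝ²)`. Since `V` is bounded, this is `D* D̄ + V` with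
`D = p - A` on `C_c^∞(ℝ²)`. -/
def hamiltonian (A : C(Plane, Plane)) (V : Plane →ᵇ ℝ) : L2 →ₗ.[ℂ] L2 :=
  potential V +ᵥ adjointCompClosure (momentum A)

/-- The resolvent set of an unbounded operator `T`: all `z` such that `T - z` is a bijection from
the domain of `T` onto the whole space with bounded inverse `R`. -/
def resolventSet (T : L2 →ₗ.[ℂ] L2) : Set ℂ :=
  {z | ∃ R : L2 →L[ℂ] L2,
    (∀ f : L2, ∃ h : R f ∈ T.domain, T ⟨R f, h⟩ - z • R f = f) ∧
    ∀ ψ : T.domain, R (T ψ - z • (ψ : L2)) = ψ}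

/-- The classical band edge `e_{n,min}[B] = inf_x [(2n+1) B(x) + V(x)]`. -/
def eMin (V B : Plane → ℝ) (n : ℕ) : ℝ := ⨅ x, ((2 * n + 1) * B x + V x)

/-- The classical band edge `e_{n,max}[B] = sup_x [(2n+1) B(x) + V(x)]`. -/
def eMax (V B : Plane → ℝ) (n : ℕ) : ℝ := ⨆ x, ((2 * n + 1) * B x + V x)

/-- `f` is differentiable with bounded gradient. -/
def HasBoundedGradient (f : Plane → ℝ) : Prop :=
  Differentiable ℝ f ∧ BddAbove (range fun x => ‖fderiv ℝ f x‖)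

/-- `‖∇f‖_∞ = sup_x |∇f(x)|`, with the Euclidean length of the gradient. -/
def gradSup (f : Plane → ℝ) : ℝ := ⨆ x, ‖fderiv ℝ f x‖

/-- `K̂₂ = ‖∇B₁‖_∞ + ‖∇V‖_∞`. -/
def K2 (B₁ V : Plane → ℝ) : ℝ := gradSup B₁ + gradSup V

/-- `K̂₃ = ‖∇B₁‖_∞²`. -/
def K3 (B₁ : Plane → ℝ) : ℝ := gradSup B₁ ^ 2

/-- The correction `K̂₂ B₀^{-1/2} + K̂₃ B₀^{-2}`. -/
def correction (B₀ : ℝ) (B₁ V : Plane → ℝ) : ℝ :=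
  K2 B₁ V * B₀ ^ (-(1 / 2) : ℝ) + K3 B₁ * B₀ ^ (-2 : ℝ)

end

end MagneticSchrodinger

/-! Put `π = p - A`, `a = π₁ + i π₂` and `c = π₁ - i π₂`. Since `[π₁, π₂] = i B`, one has `c a = π²
- B` and `a c = π² + B`. Hence `H - E = c a + W` with `W = B + V - E`, and `a c = c a + β` with `β =
2 B`. The functions `W + k β = (2k+1) B + V - E` are the local Landau levels seen from `E`. In the
gap they are at most `-d` for `k ≤ n` and at least `d` for `k = n + 1`.

The operator `c a + W + (n+1) β` is at least `d`, because `c a ≥ 0`. From there one descends a level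
at a time: `a (c a + W) = (c a + W + β) a + [a, W]`, so a lower bound for `c a + W + β` controls `a
ψ` by `f = (c a + W) ψ`, up to a commutator of size `|∇W|`. What remains of `ψ` is its component in
the kernel of `a`, and there `W ≤ -d` alone gives a bound. The commutator errors are absorbed when
`|∇W|` is small against `d √B₀`, that is, when `d` is at least a large multiple of `K̂₂ B₀^{-1/2}`.
This step is `LowerBound.of_add_comm`, and `lowerBound_of_ladder` iterates it. As `c a + W` is
symmetric with `c a` self-adjoint, a lower bound already gives a bounded inverse
(`LowerBound.exists_resolvent`).

The analytic part shows that the magnetic operators fit this scheme: `a` and `c` are closed and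
mutually adjoint on one common domain, the form domain of `H`. Friedrichs mollification and cutoffs
give that weak `a`- or `c`-derivatives are strong (`IsWeakLadder.exists_test_approx`). As `B` is
bounded, one such derivative controls the whole of `π u` (`norm_momentumTest_le`). Finally
`hamiltonian_iff` identifies the Friedrichs extension with `c a + B + V`, domains included. -/

open MeasureTheory Set TopologicalSpace Filter Topology
open scoped ContDiff BoundedContinuousFunction Distributions LinearPMap
open scoped InnerProductSpace ComplexConjugate Convolution

namespace MagneticSchrodinger

noncomputable section

/-! ### Abstract ladder operators and the operator `c a`. -/

section Abstract

variable {𝓗 : Type*} [NormedAddCommGroup 𝓗] [InnerProductSpace ℂ 𝓗]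

/-- A pair of mutually adjoint closed operators `a`, `c` with a common domain and with
`a c = c a + β` in the sense of quadratic forms, for a bounded operator `β`. -/
structure LadderPair (𝓗 : Type*) [NormedAddCommGroup 𝓗] [InnerProductSpace ℂ 𝓗] where
  /-- The common domain. -/
  dom : Submodule ℂ 𝓗
  /-- The annihilation operator. -/
  a : dom →ₗ[ℂ] 𝓗
  /-- The creation operator. -/
  c : dom →ₗ[ℂ] 𝓗
  /-- The commutator of `a` and `c`. -/
  β : 𝓗 →L[ℂ] 𝓗
  inner_a : ∀ u v : dom, ⟪a u, (v : 𝓗)⟫_ℂ = ⟪(u : 𝓗), c v⟫_ℂ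
  a_max : ∀ u g : 𝓗, (∀ v : dom, ⟪c v, u⟫_ℂ = ⟪(v : 𝓗), g⟫_ℂ) → ∃ h : u ∈ dom, a ⟨u, h⟩ = g
  c_max : ∀ u g : 𝓗, (∀ v : dom, ⟪a v, u⟫_ℂ = ⟪(v : 𝓗), g⟫_ℂ) → ∃ h : u ∈ dom, c ⟨u, h⟩ = g
  comm : ∀ u v : dom, ⟪c u, c v⟫_ℂ = ⟪a u, a v⟫_ℂ + ⟪(u : 𝓗), β v⟫_ℂ

namespace LadderPair

/-- The arithmetic closing the induction step: `r` is the square root of the lower bound of `β`, and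
the other letters `f, φ, ψ, ψ₀, ζ, cζ` are the norms of the vectors so named in
`LowerBound.of_add_comm`. Once the bound for `φ` is inserted into those for `ψ₀` and `cζ`, the
unknown `ψ` reappears on the right with factor `(1 + η) η M ≤ 1/2` and is absorbed. This doubles the
remaining terms, whence `2 + 4 s M`. -/
theorem le_of_ladder_estimates {r d G s η M f φ ψ ψ₀ ζ cζ : ℝ} (hr : 0 < r) (hd : 0 < d)
    (hM : 1 ≤ M) (hs : 0 ≤ s) (hη : 0 ≤ η) (hηM : 4 * M * η ≤ 1) (hG : G ≤ η * d * r)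
    (hf : 0 ≤ f) (hψ : 0 ≤ ψ) (hζ : 0 ≤ ζ)
    (hφb : d * φ ≤ M * (s * r) * f + G * M * ψ) (hζb : r ^ 2 * ζ ≤ φ)
    (hψ₀b : d * ψ₀ ≤ f + G * ζ) (hcζ : r * cζ ≤ φ) (hψb : ψ ≤ ψ₀ + cζ) :
    ψ ≤ (2 + 4 * s * M) / d * f := by
  have hM0 : 0 ≤ M := by linarith
  have hη1 : η ≤ 1 / 4 := by nlinarith
  have t1 : r * (G * ζ) ≤ η * d * φ := by
    calc r * (G * ζ) ≤ r * ((η * d * r) * ζ) := by gcongr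
      _ = η * d * (r ^ 2 * ζ) := by ring
      _ ≤ _ := by gcongr
  have t2 : d * φ ≤ M * (s * r) * f + η * d * r * M * ψ := hφb.trans (by gcongr)
  have t4 : d * r * ψ ≤ r * f + (1 + η) * (M * (s * r) * f + η * d * r * M * ψ) := by
    calc d * r * ψ ≤ d * r * (ψ₀ + cζ) := by gcongr
      _ = r * (d * ψ₀) + d * (r * cζ) := by ring
      _ ≤ r * (f + G * ζ) + d * φ := by gcongr
      _ ≤ r * f + (1 + η) * (d * φ) := by linarith
      _ ≤ _ := by gcongr
  have t5 : (1 + η) * (η * M) ≤ 1 / 2 := by nlinarith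
  have t6 : (1 + η) * (η * d * r * M * ψ) ≤ 1 / 2 * (d * r * ψ) := by
    calc _ = ((1 + η) * (η * M)) * (d * r * ψ) := by ring
      _ ≤ _ := by gcongr
  have t7 : (1 + η) * (M * (s * r) * f) ≤ 2 * (M * (s * r) * f) := by
    gcongr; linarith
  have t8 : r * (d * ψ) ≤ r * ((2 + 4 * s * M) * f) := by linarith
  rw [div_mul_eq_mul_div, le_div_iff₀ hd, mul_comm]
  exact le_of_mul_le_mul_left t8 hr

variable (L : LadderPair 𝓗)

/-- `u` lies in the domain of `c a` and `c a u = f`. -/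
def IsKin (u f : 𝓗) : Prop :=
  ∃ (h : u ∈ L.dom) (h' : L.a ⟨u, h⟩ ∈ L.dom), L.c ⟨L.a ⟨u, h⟩, h'⟩ = f

variable {L}

theorem inner_c (u v : L.dom) : ⟪L.c u, (v : 𝓗)⟫_ℂ = ⟪(u : 𝓗), L.a v⟫_ℂ := by
  rw [← inner_conj_symm, ← L.inner_a v u, inner_conj_symm]

/-- As `c` is the full adjoint of `a`, the weak equation already forces `a u` into the domain of
`c`. The weak form is linear in `(u, f)` and carries a single domain condition. -/
theorem isKin_iff {u f : 𝓗} :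
    L.IsKin u f ↔ ∃ h : u ∈ L.dom, ∀ v : L.dom, ⟪L.a v, L.a ⟨u, h⟩⟫_ℂ = ⟪(v : 𝓗), f⟫_ℂ := by
  constructor
  · rintro ⟨h, h', rfl⟩
    exact ⟨h, fun v => L.inner_a v ⟨_, h'⟩⟩
  · rintro ⟨h, hv⟩
    obtain ⟨h', e⟩ := L.c_max _ _ hv
    exact ⟨h, h', e⟩

theorem IsKin.sub {u u' f f' : 𝓗} (h : L.IsKin u f) (h' : L.IsKin u' f') :
    L.IsKin (u - u') (f - f') := by
  rw [isKin_iff] at *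
  obtain ⟨h, e⟩ := h
  obtain ⟨h', e'⟩ := h'
  refine ⟨L.dom.sub_mem h h', fun v => ?_⟩
  have : (⟨u - u', L.dom.sub_mem h h'⟩ : L.dom) = ⟨u, h⟩ - ⟨u', h'⟩ := rfl
  rw [this, map_sub, inner_sub_right, inner_sub_right, e, e']

theorem IsKin.add {u u' f f' : 𝓗} (h : L.IsKin u f) (h' : L.IsKin u' f') :
    L.IsKin (u + u') (f + f') := by
  rw [isKin_iff] at *
  obtain ⟨h, e⟩ := h
  obtain ⟨h', e'⟩ := h'
  refine ⟨L.dom.add_mem h h', fun v => ?_⟩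
  have : (⟨u + u', L.dom.add_mem h h'⟩ : L.dom) = ⟨u, h⟩ + ⟨u', h'⟩ := rfl
  rw [this, map_add, inner_add_right, inner_add_right, e, e']

theorem IsKin.smul {u f : 𝓗} (z : ℂ) (h : L.IsKin u f) : L.IsKin (z • u) (z • f) := by
  rw [isKin_iff] at *
  obtain ⟨h, e⟩ := h
  refine ⟨L.dom.smul_mem z h, fun v => ?_⟩
  have : (⟨z • u, L.dom.smul_mem z h⟩ : L.dom) = z • ⟨u, h⟩ := rfl
  rw [this, map_smul, inner_smul_right, inner_smul_right, e]

theorem IsKin.inner_self {u f : 𝓗} (h : L.IsKin u f) : 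
    ⟪u, f⟫_ℂ = ((‖L.a ⟨u, h.1⟩‖ ^ 2 : ℝ) : ℂ) := by
  obtain ⟨h0, e⟩ := isKin_iff.1 h
  rw [← e ⟨u, h0⟩, inner_self_eq_norm_sq_to_K]
  simp

theorem IsKin.inner_symm {u f v g : 𝓗} (h : L.IsKin u f) (h' : L.IsKin v g) :
    ⟪u, g⟫_ℂ = ⟪f, v⟫_ℂ := by
  obtain ⟨h0, e⟩ := isKin_iff.1 h
  obtain ⟨h0', e'⟩ := isKin_iff.1 h'
  rw [← e' ⟨u, h0⟩, ← inner_conj_symm f, ← e ⟨v, h0'⟩, inner_conj_symm]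

variable (L) in
/-- `c a + W` is bounded below by `K⁻¹`. -/
def LowerBound (W : 𝓗 →L[ℂ] 𝓗) (K : ℝ) : Prop :=
  ∀ u f : 𝓗, L.IsKin u f → ‖u‖ ≤ K * ‖f + W u‖

theorem LowerBound.unique {W : 𝓗 →L[ℂ] 𝓗} {K : ℝ} (hK : L.LowerBound W K) {u u' v : 𝓗}
    (h : L.IsKin u (v - W u)) (h' : L.IsKin u' (v - W u')) : u = u' := by
  have := hK _ _ (h.sub h')
  have e : v - W u - (v - W u') + W (u - u') = 0 := by rw [map_sub]; abel
  rw [e, norm_zero, mul_zero] at this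
  exact sub_eq_zero.1 (norm_le_zero_iff.1 this)

/-- If `c a + W` is bounded below and surjective, it has a bounded inverse. -/
theorem LowerBound.exists_inverse {W : 𝓗 →L[ℂ] 𝓗} {K : ℝ} (hK : L.LowerBound W K)
    (hs : ∀ v, ∃ u, L.IsKin u (v - W u)) :
    ∃ R : 𝓗 →L[ℂ] 𝓗, (∀ v, L.IsKin (R v) (v - W (R v))) ∧ ∀ v, ‖R v‖ ≤ K * ‖v‖ := by
  choose R hR using hs
  let Rl : 𝓗 →ₗ[ℂ] 𝓗 :=
    { toFun := R
      map_add' := fun v w => by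
        refine hK.unique (hR _) ?_
        convert (hR v).add (hR w) using 1
        rw [map_add]; abel
      map_smul' := fun z v => by
        refine hK.unique (hR _) ?_
        rw [RingHom.id_apply]
        convert (hR v).smul z using 1
        rw [map_smul, smul_sub] }
  have hb : ∀ v, ‖R v‖ ≤ K * ‖v‖ := fun v => by
    simpa using hK _ _ (hR v)
  exact ⟨Rl.mkContinuous K hb, hR, hb⟩

/-- Follows from `c a ≥ 0` and Cauchy–Schwarz. The inverse of `c a + 1` later serves to describe the
domain of `c a` by a bounded operator. -/
theorem lowerBound_one : L.LowerBound (1 : 𝓗 →L[ℂ] 𝓗) 1 := by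
  intro u f h
  rw [one_mul]
  have h1 : ‖u‖ ^ 2 ≤ ‖u‖ * ‖f + u‖ := by
    calc ‖u‖ ^ 2 ≤ ‖L.a ⟨u, h.1⟩‖ ^ 2 + ‖u‖ ^ 2 := by nlinarith [sq_nonneg ‖L.a ⟨u, h.1⟩‖]
      _ = (⟪u, f + u⟫_ℂ).re := by
        rw [inner_add_right, h.inner_self, Complex.add_re, Complex.ofReal_re]
        congr 1
        exact (inner_self_eq_norm_sq (𝕜 := ℂ) u).symm
      _ ≤ _ := (Complex.re_le_norm _).trans (norm_inner_le_norm _ _)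
  by_contra! hc
  have : ‖f + u‖ < ‖u‖ := hc
  have := norm_nonneg (f + u)
  nlinarith

/-- `c a + W` is bounded below if `W ≥ d > 0`. -/
theorem lowerBound_of_pos {W : 𝓗 →L[ℂ] 𝓗} {d : ℝ} (hd : 0 < d)
    (hW : ∀ u, d * ‖u‖ ^ 2 ≤ (⟪u, W u⟫_ℂ).re) : L.LowerBound W (1 / d) := by
  intro u f h
  have h1 : d * ‖u‖ ^ 2 ≤ ‖u‖ * ‖f + W u‖ := by
    calc d * ‖u‖ ^ 2 ≤ ‖L.a ⟨u, h.1⟩‖ ^ 2 + (⟪u, W u⟫_ℂ).re := by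
          nlinarith [sq_nonneg ‖L.a ⟨u, h.1⟩‖, hW u]
      _ = (⟪u, f + W u⟫_ℂ).re := by
        rw [inner_add_right, h.inner_self, Complex.add_re, Complex.ofReal_re]
      _ ≤ _ := (Complex.re_le_norm _).trans (norm_inner_le_norm _ _)
  rw [one_div, inv_mul_eq_div, le_div_iff₀ hd]
  rcases (norm_nonneg u).eq_or_lt with h0 | h0
  · rw [← h0, zero_mul]; exact norm_nonneg _
  · exact le_of_mul_le_mul_left (by nlinarith) h0

/-! ### Self-adjointness of `c a` and invertibility of its bounded symmetric perturbations. -/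

variable [CompleteSpace 𝓗]

/-- Von Neumann's argument that `a* a + 1` is onto. The graph of `a` is closed, since `a_max`
exhibits it as an intersection of closed conditions. Project `(v, 0)` orthogonally onto it to get
`(u, a u)`; orthogonality of the residual `(v - u, -a u)` to all `(w, a w)` is the weak form of `c a
u = v - u`. -/
theorem exists_isKin_sub (v : 𝓗) : ∃ u, L.IsKin u (v - u) := by
  let K : Submodule ℂ (WithLp 2 (𝓗 × 𝓗)) :=
    { carrier := {p | ∃ h : p.fst ∈ L.dom, L.a ⟨p.fst, h⟩ = p.snd}
      zero_mem' := ⟨L.dom.zero_mem, L.a.map_zero⟩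
      add_mem' := by
        rintro p q ⟨h, e⟩ ⟨h', e'⟩
        refine ⟨L.dom.add_mem h h', ?_⟩
        rw [WithLp.add_snd, ← e, ← e', ← map_add]
        rfl
      smul_mem' := by
        rintro z p ⟨h, e⟩
        refine ⟨L.dom.smul_mem z h, ?_⟩
        rw [WithLp.smul_snd, ← e, ← map_smul]
        rfl }
  have hK : (K : Set (WithLp 2 (𝓗 × 𝓗))) = ⋂ w : L.dom,
      {p | ⟪L.c w, p.fst⟫_ℂ = ⟪(w : 𝓗), p.snd⟫_ℂ} := by
    ext p
    simp only [mem_iInter, mem_ofPred_eq, SetLike.mem_coe]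
    constructor
    · rintro ⟨h, e⟩ w
      rw [← e]
      exact inner_c w ⟨_, h⟩
    · exact fun h => L.a_max _ _ h
  have hKc : IsClosed (K : Set (WithLp 2 (𝓗 × 𝓗))) := by
    rw [hK]
    refine isClosed_iInter fun w => isClosed_eq ?_ ?_
    · exact continuous_const.inner (WithLp.continuous_fst 2 𝓗 𝓗)
    · exact continuous_const.inner (WithLp.continuous_snd 2 𝓗 𝓗)
  have : CompleteSpace K := hKc.completeSpace_coe
  obtain ⟨y, hy, z, hz, e⟩ := K.exists_add_mem_mem_orthogonal (WithLp.toLp 2 (v, 0))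
  obtain ⟨h, ea⟩ := hy
  have e1 : v = y.fst + z.fst := congrArg WithLp.fst e
  have e2 : (0 : 𝓗) = y.snd + z.snd := congrArg WithLp.snd e
  refine ⟨y.fst, isKin_iff.2 ⟨h, fun w => ?_⟩⟩
  have := (K.mem_orthogonal z).1 hz (WithLp.toLp 2 ((w : 𝓗), L.a w)) ⟨w.2, rfl⟩
  replace this : ⟪(w : 𝓗), z.fst⟫_ℂ + ⟪L.a w, z.snd⟫_ℂ = 0 := this
  have e3 : L.a ⟨y.fst, h⟩ = - z.snd := by rw [ea]; exact eq_neg_of_add_eq_zero_left e2.symm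
  have e4 : v - y.fst = z.fst := by rw [e1]; abel
  rw [e3, e4, inner_neg_right]
  linear_combination -this

/-- A symmetric bounded perturbation of `c a` that is bounded below is invertible. -/
theorem LowerBound.exists_resolvent {W : 𝓗 →L[ℂ] 𝓗} {K : ℝ} (hK : L.LowerBound W K)
    (hW : ∀ u v, ⟪W u, v⟫_ℂ = ⟪u, W v⟫_ℂ) :
    ∃ R : 𝓗 →L[ℂ] 𝓗, (∀ v, L.IsKin (R v) (v - W (R v))) ∧ ∀ v, ‖R v‖ ≤ K * ‖v‖ := by
  refine hK.exists_inverse ?_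
  obtain ⟨R, hR, -⟩ := (lowerBound_one (L := L)).exists_inverse (fun v => exists_isKin_sub v)
  simp only [one_apply_eq_self] at hR
  -- With `R = (c a + 1)⁻¹`, membership in the domain of `c a` becomes an equation for a bounded
  -- operator, which passes to limits.
  have hR' : ∀ u f, L.IsKin u f ↔ R (f + u) = u := by
    intro u f
    constructor
    · intro h
      refine lowerBound_one.unique (hR _) ?_
      simpa using h
    · intro h
      have := hR (f + u)
      rwa [h, add_sub_cancel_right] at this
  have hRs : ∀ u v, ⟪R u, v⟫_ℂ = ⟪u, R v⟫_ℂ := by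
    intro u v
    have := (hR u).inner_symm (hR v)
    rw [inner_sub_left, inner_sub_right] at this
    linear_combination this
  -- The range of `c a + W`. It is closed by the lower bound, and its orthogonal complement is
  -- trivial by symmetry.
  let M : Submodule ℂ 𝓗 :=
    { carrier := {v | ∃ u, L.IsKin u (v - W u)}
      zero_mem' := ⟨0, (hR' _ _).2 (by simp)⟩
      add_mem' := by
        rintro v v' ⟨u, h⟩ ⟨u', h'⟩
        refine ⟨u + u', ?_⟩
        convert h.add h' using 1
        rw [map_add]; abel
      smul_mem' := by
        rintro z v ⟨u, h⟩
        refine ⟨z • u, ?_⟩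
        convert h.smul z using 1
        rw [map_smul, smul_sub] }
  have hMc : IsClosed (M : Set 𝓗) := by
    refine IsSeqClosed.isClosed fun v v₀ hv hlim => ?_
    choose u hu using hv
    have hc : CauchySeq u := by
      -- No sign of `K` is assumed, hence the maximum.
      have h1 : ∀ m k, dist (u m) (u k) ≤ max K 0 * dist (v m) (v k) := by
        intro m k
        rw [dist_eq_norm, dist_eq_norm]
        have h := hK _ _ ((hu m).sub (hu k))
        have e : v m - W (u m) - (v k - W (u k)) + W (u m - u k) = v m - v k := by
          rw [map_sub]; abel
        rw [e] at h
        exact h.trans (mul_le_mul_of_nonneg_right (le_max_left _ _) (norm_nonneg _))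
      have hvc := hlim.cauchySeq
      rw [Metric.cauchySeq_iff] at hvc ⊢
      intro ε hε
      obtain ⟨N, hN⟩ := hvc (ε / (max K 0 + 1)) (by positivity)
      refine ⟨N, fun m hm k hk => (h1 m k).trans_lt ?_⟩
      have h2 := hN m hm k hk
      have h3 : (0 : ℝ) ≤ max K 0 := le_max_right _ _
      rw [lt_div_iff₀ (by positivity)] at h2
      nlinarith [dist_nonneg (x := v m) (y := v k)]
    obtain ⟨u₀, hu₀⟩ := cauchySeq_tendsto_of_complete hc
    refine ⟨u₀, (hR' _ _).2 ?_⟩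
    have h1 : Tendsto (fun k => R (v k - W (u k) + u k)) atTop (𝓝 (R (v₀ - W u₀ + u₀))) :=
      (R.continuous.tendsto _).comp ((hlim.sub ((W.continuous.tendsto _).comp hu₀)).add hu₀)
    have h2 : (fun k => R (v k - W (u k) + u k)) = u := by
      funext k
      exact (hR' _ _).1 (hu k)
    rw [h2] at h1
    exact tendsto_nhds_unique h1 hu₀
  have : CompleteSpace M := hMc.completeSpace_coe
  have hM : M = ⊤ := by
    rw [← Submodule.orthogonal_eq_bot_iff, Submodule.eq_bot_iff]
    intro g hg
    -- The vector `(c a + W) R w = w - R w + W R w` lies in the range. Moving `R` and `W` onto `g`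
    -- gives `g = R (g - W g)`, so that `(c a + W) g = 0` and the lower bound forces `g = 0`.
    have h1 : ∀ w, ⟪w, g - R g + R (W g)⟫_ℂ = 0 := by
      intro w
      have := (M.mem_orthogonal g).1 hg (w - R w + W (R w)) ⟨R w, by simpa using hR w⟩
      rw [← this, inner_add_left, inner_sub_left, inner_add_right, inner_sub_right, hRs, hW, hRs]
    have h2 : g - R g + R (W g) = 0 := inner_self_eq_zero.1 (h1 _)
    have h3 : L.IsKin g (-W g) := (hR' _ _).2 (by
      rw [map_add, map_neg, ← sub_eq_zero, ← neg_eq_zero, ← h2]; abel)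
    have := hK _ _ h3
    simpa using this
  intro v
  have : v ∈ M := hM ▸ Submodule.mem_top
  exact this

/-! ### Descending the ladder: from `c a + W + β` to `c a + W`. -/

variable (L) in
/-- The bounded operator `W` preserves the domain, and its commutators with `a` and `c` are bounded
by `G`. -/
def CommBound (W : 𝓗 →L[ℂ] 𝓗) (G : ℝ) : Prop :=
  ∀ u : L.dom, ∃ h : W u ∈ L.dom,
    ‖L.a ⟨W u, h⟩ - W (L.a u)‖ ≤ G * ‖(u : 𝓗)‖ ∧ ‖L.c ⟨W u, h⟩ - W (L.c u)‖ ≤ G * ‖(u : 𝓗)‖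

/-- The component of `u` orthogonal to the kernel of `a` is `c ζ` with `a c ζ = a u`. -/
theorem exists_ladder_preimage {β₀ : ℝ} (hβ₀ : 0 < β₀)
    (hβs : ∀ u v, ⟪L.β u, v⟫_ℂ = ⟪u, L.β v⟫_ℂ)
    (hβ : ∀ u, β₀ * ‖u‖ ^ 2 ≤ (⟪u, L.β u⟫_ℂ).re) (φ : 𝓗) :
    ∃ (ζ : L.dom) (h : L.c ζ ∈ L.dom), L.a ⟨L.c ζ, h⟩ = φ ∧ β₀ * ‖(ζ : 𝓗)‖ ≤ ‖φ‖ ∧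
      β₀ * ‖L.c ζ‖ ^ 2 ≤ ‖φ‖ ^ 2 := by
  -- Here `R = (c a + β)⁻¹` plays the role of `(a c)⁻¹`, and `ζ = R φ`. The bound on `c ζ` comes
  -- from `‖c ζ‖² = ⟪ζ, a c ζ⟫ = ⟪ζ, φ⟫`.
  obtain ⟨R, hR, hRb⟩ := (lowerBound_of_pos (L := L) hβ₀ hβ).exists_resolvent hβs
  obtain ⟨h, e⟩ := isKin_iff.1 (hR φ)
  have e' : ∀ v : L.dom, ⟪L.c v, L.c ⟨R φ, h⟩⟫_ℂ = ⟪(v : 𝓗), φ⟫_ℂ := by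
    intro v
    rw [L.comm, e v, ← inner_add_right, sub_add_cancel]
  obtain ⟨h', e''⟩ := L.a_max _ _ e'
  have hb : β₀ * ‖R φ‖ ≤ ‖φ‖ := by
    have := hRb φ
    rwa [one_div, inv_mul_eq_div, le_div_iff₀ hβ₀, mul_comm] at this
  refine ⟨⟨R φ, h⟩, h', e'', hb, ?_⟩
  have h1 : ‖L.c ⟨R φ, h⟩‖ ^ 2 ≤ ‖R φ‖ * ‖φ‖ := by
    calc ‖L.c ⟨R φ, h⟩‖ ^ 2 = (⟪L.c ⟨R φ, h⟩, L.c ⟨R φ, h⟩⟫_ℂ).re :=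
          (inner_self_eq_norm_sq (𝕜 := ℂ) _).symm
      _ = (⟪R φ, φ⟫_ℂ).re := by rw [e']
      _ ≤ _ := (Complex.re_le_norm _).trans (norm_inner_le_norm _ _)
  nlinarith [norm_nonneg φ]

/-- The induction step: a resolvent bound for `c a + W + β` gives one for `c a + W`, provided that
`W` is negative and its commutators with `a` and `c` are small. -/
theorem LowerBound.of_add_comm {W : 𝓗 →L[ℂ] 𝓗} {β₀ d G S s η M : ℝ} (hβ₀ : 0 < β₀)
    (hβs : ∀ u v, ⟪L.β u, v⟫_ℂ = ⟪u, L.β v⟫_ℂ)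
    (hβ : ∀ u, β₀ * ‖u‖ ^ 2 ≤ (⟪u, L.β u⟫_ℂ).re) (hd : 0 < d)
    (hWs : ∀ u v, ⟪W u, v⟫_ℂ = ⟪u, W v⟫_ℂ) (hWG : L.CommBound W G) (hG : 0 ≤ G)
    (hWd : ∀ u, d * ‖u‖ ^ 2 ≤ -(⟪u, W u⟫_ℂ).re) (hWS : ∀ u, -(⟪u, W u⟫_ℂ).re ≤ S * ‖u‖ ^ 2)
    (hM : 1 ≤ M) (hs : 0 ≤ s) (hS : 0 ≤ S) (hsS : d + S ≤ s ^ 2 * β₀) (hη : 0 ≤ η)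
    (hηM : 4 * M * η ≤ 1) (hGη : G ≤ η * d * √β₀) (hK : L.LowerBound (W + L.β) (M / d)) :
    L.LowerBound W ((2 + 4 * s * M) / d) := by
  obtain ⟨R, hR, hRb⟩ := hK.exists_resolvent (fun u v => by
    rw [add_apply, add_apply, inner_add_left, inner_add_right, hWs, hβs])
  intro ψ g hψ
  obtain ⟨h0, h1, rfl⟩ := hψ
  set φ : 𝓗 := L.a ⟨ψ, h0⟩ with hφ
  set f : 𝓗 := L.c ⟨φ, h1⟩ + W ψ with hf
  set r := √β₀ with hr
  have hrpos : 0 < r := Real.sqrt_pos.2 hβ₀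
  have hrr : β₀ = r ^ 2 := (Real.sq_sqrt hβ₀.le).symm
  set N := M / d * (s * r) with hN
  have hMd : 0 ≤ M / d := div_nonneg (by linarith) hd.le
  -- Formally `(c a + W + β) φ = a f - [a, W] ψ`, but `f` need not lie in the domain of `a`. So pair
  -- `φ` with `φ = (c a + W + β) x`, where `x = R φ`, and move the operators across: `‖φ‖² = ⟪f, c
  -- x⟫ + ⟪ψ, [c, W] x⟫`.
  have hφb : ‖φ‖ ≤ N * ‖f‖ + G * (M / d) * ‖ψ‖ := by
    obtain ⟨hx, ex⟩ := isKin_iff.1 (hR φ)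
    set x : L.dom := ⟨R φ, hx⟩ with hxdef
    have hxb : ‖(x : 𝓗)‖ ≤ M / d * ‖φ‖ := hRb φ
    obtain ⟨hWx, -, hc⟩ := hWG x
    have key : ⟪φ, φ⟫_ℂ = ⟪f, L.c x⟫_ℂ + ⟪ψ, L.c ⟨W x, hWx⟩ - W (L.c x)⟫_ℂ := by
      have e1 := ex ⟨φ, h1⟩
      have e2 := L.comm ⟨φ, h1⟩ x
      have e3 : ⟪φ, W x⟫_ℂ = ⟪ψ, L.c ⟨W x, hWx⟩⟫_ℂ := L.inner_a ⟨ψ, h0⟩ ⟨W x, hWx⟩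
      have e4 := hWs ψ (L.c x)
      simp only [add_apply, inner_sub_right, inner_add_right] at e1
      rw [hf, inner_add_left, inner_sub_right]
      change _ = ⟪φ, φ⟫_ℂ - (⟪φ, W x⟫_ℂ + ⟪φ, L.β x⟫_ℂ) at e1
      change _ = ⟪L.a ⟨φ, h1⟩, L.a x⟫_ℂ + ⟪φ, L.β x⟫_ℂ at e2
      linear_combination -e1 - e2 + e3 - e4
    -- From `‖c x‖² = ⟪x, (c a + β) x⟫ = ⟪x, φ⟫ - ⟪x, W x⟫`. Since `M ≥ 1`, `M / d ≤ (M / d)² d`, so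
    -- both terms fit into `(M / d)² (d + S) ‖φ‖²`; the condition on `s` turns this into `N²‖φ‖²`.
    have hcx : ‖L.c x‖ ≤ N * ‖φ‖ := by
      have e1 := ex x
      have e2 := L.comm x x
      simp only [add_apply, inner_sub_right, inner_add_right] at e1
      change _ = ⟪(x : 𝓗), φ⟫_ℂ - (⟪(x : 𝓗), W x⟫_ℂ + ⟪(x : 𝓗), L.β x⟫_ℂ) at e1
      have e3 : ⟪L.c x, L.c x⟫_ℂ = ⟪(x : 𝓗), φ⟫_ℂ - ⟪(x : 𝓗), W x⟫_ℂ := by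
        linear_combination e1 + e2
      have e4 : ‖L.c x‖ ^ 2 = (⟪(x : 𝓗), φ⟫_ℂ).re - (⟪(x : 𝓗), W x⟫_ℂ).re := by
        rw [← Complex.sub_re, ← e3]
        exact (inner_self_eq_norm_sq (𝕜 := ℂ) _).symm
      have e5 : (⟪(x : 𝓗), φ⟫_ℂ).re ≤ ‖(x : 𝓗)‖ * ‖φ‖ :=
        (Complex.re_le_norm _).trans (norm_inner_le_norm _ _)
      have e6 : ‖L.c x‖ ^ 2 ≤ (N * ‖φ‖) ^ 2 := by
        calc ‖L.c x‖ ^ 2 ≤ ‖(x : 𝓗)‖ * ‖φ‖ + S * ‖(x : 𝓗)‖ ^ 2 := by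
              linarith [hWS x]
          _ ≤ (M / d * ‖φ‖) * ‖φ‖ + S * (M / d * ‖φ‖) ^ 2 := by gcongr
          _ ≤ (M / d) ^ 2 * ‖φ‖ ^ 2 * (d + S) := by
            have : M / d ≤ (M / d) ^ 2 * d := by
              rw [div_pow, div_mul_eq_mul_div, div_le_div_iff₀ hd (by positivity)]
              nlinarith [mul_pos hd hd, mul_nonneg (sub_nonneg.2 hM) (mul_pos hd hd).le]
            nlinarith [mul_le_mul_of_nonneg_right this (sq_nonneg ‖φ‖)]
          _ ≤ (M / d) ^ 2 * ‖φ‖ ^ 2 * (s ^ 2 * β₀) := by gcongr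
          _ = _ := by rw [hN, hrr]; ring
      exact le_of_sq_le_sq e6 (by positivity)
    have h2 : ‖φ‖ ^ 2 ≤ (N * ‖f‖ + G * (M / d) * ‖ψ‖) * ‖φ‖ := by
      calc ‖φ‖ ^ 2 = ‖⟪φ, φ⟫_ℂ‖ := by
            rw [inner_self_eq_norm_sq_to_K]
            simp
        _ ≤ ‖f‖ * ‖L.c x‖ + ‖ψ‖ * ‖L.c ⟨W x, hWx⟩ - W (L.c x)‖ := by
            rw [key]
            exact (norm_add_le _ _).trans (add_le_add (norm_inner_le_norm _ _)
              (norm_inner_le_norm _ _))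
        _ ≤ ‖f‖ * (N * ‖φ‖) + ‖ψ‖ * (G * (M / d * ‖φ‖)) := by
            gcongr
            exact hc.trans (by gcongr)
        _ = _ := by ring
    rcases (norm_nonneg φ).eq_or_lt with h3 | h3
    · rw [← h3]; positivity
    · exact le_of_mul_le_mul_right (by nlinarith) h3
  -- Split `ψ = ψ₀ + c ζ` with `a ψ₀ = 0`; the part `c ζ` is controlled by `φ`.
  obtain ⟨ζ, hζ, eζ, hζ1, hζ2⟩ := exists_ladder_preimage hβ₀ hβs hβ φ
  set ψ₀ : L.dom := ⟨ψ, h0⟩ - ⟨L.c ζ, hζ⟩ with hψ₀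
  have haψ₀ : L.a ψ₀ = 0 := by rw [hψ₀, map_sub, eζ, ← hφ, sub_self]
  have eψ : ψ = (ψ₀ : 𝓗) + L.c ζ := by rw [hψ₀]; simp
  -- Pair the equation with `ψ₀`. The term `c a ψ` drops out, `-W ≥ d` gives the left side, and the
  -- cross term is `⟪W ψ₀, c ζ⟫ = ⟪a W ψ₀, ζ⟫ = ⟪[a, W] ψ₀, ζ⟫`, because `a ψ₀ = 0`.
  have hψ₀b : d * ‖(ψ₀ : 𝓗)‖ ≤ ‖f‖ + G * ‖(ζ : 𝓗)‖ := by
    obtain ⟨hWψ, ha, -⟩ := hWG ψ₀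
    rw [haψ₀, map_zero, sub_zero] at ha
    have e1 : ⟪(ψ₀ : 𝓗), f⟫_ℂ = ⟪(ψ₀ : 𝓗), W ψ₀⟫_ℂ + ⟪L.a ⟨W ψ₀, hWψ⟩, (ζ : 𝓗)⟫_ℂ := by
      have e2 : ⟪(ψ₀ : 𝓗), L.c ⟨φ, h1⟩⟫_ℂ = 0 := by
        rw [← L.inner_a, haψ₀, inner_zero_left]
      have e3 : ⟪(ψ₀ : 𝓗), W ψ⟫_ℂ = ⟪(ψ₀ : 𝓗), W ψ₀⟫_ℂ + ⟪W ψ₀, L.c ζ⟫_ℂ := by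
        conv_lhs => rw [eψ, map_add, inner_add_right]
        rw [hWs]
      rw [hf, inner_add_right, e2, zero_add, e3, L.inner_a]
    have e4 : d * ‖(ψ₀ : 𝓗)‖ ^ 2 ≤ (‖f‖ + G * ‖(ζ : 𝓗)‖) * ‖(ψ₀ : 𝓗)‖ := by
      have e5 : -(⟪(ψ₀ : 𝓗), W ψ₀⟫_ℂ).re
          = (⟪L.a ⟨W ψ₀, hWψ⟩, (ζ : 𝓗)⟫_ℂ).re - (⟪(ψ₀ : 𝓗), f⟫_ℂ).re := by
        rw [e1, Complex.add_re]; ring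
      have e6 : (⟪L.a ⟨W ψ₀, hWψ⟩, (ζ : 𝓗)⟫_ℂ).re ≤ G * ‖(ψ₀ : 𝓗)‖ * ‖(ζ : 𝓗)‖ :=
        (Complex.re_le_norm _).trans ((norm_inner_le_norm _ _).trans (by gcongr))
      have e7 : -(⟪(ψ₀ : 𝓗), f⟫_ℂ).re ≤ ‖(ψ₀ : 𝓗)‖ * ‖f‖ :=
        (neg_le_abs _).trans ((Complex.abs_re_le_norm _).trans (norm_inner_le_norm _ _))
      have := hWd ψ₀
      linarith
    rcases (norm_nonneg (ψ₀ : 𝓗)).eq_or_lt with h3 | h3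
    · rw [← h3, mul_zero]; positivity
    · exact le_of_mul_le_mul_right (by nlinarith) h3
  have hcζ : r * ‖L.c ζ‖ ≤ ‖φ‖ := by
    refine le_of_sq_le_sq ?_ (norm_nonneg _)
    rw [mul_pow, ← hrr]
    exact hζ2
  have t : ‖ψ‖ ≤ ‖(ψ₀ : 𝓗)‖ + ‖L.c ζ‖ := by
    conv_lhs => rw [eψ]
    exact norm_add_le _ _
  have hφb' : d * ‖φ‖ ≤ M * (s * r) * ‖f‖ + G * M * ‖ψ‖ := by
    calc d * ‖φ‖ ≤ d * (N * ‖f‖ + G * (M / d) * ‖ψ‖) := by gcongr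
      _ = M * (s * r) * ‖f‖ + G * M * ‖ψ‖ := by rw [hN]; field_simp
  exact le_of_ladder_estimates hrpos hd hM hs hη hηM hGη (norm_nonneg _) (norm_nonneg _)
    (norm_nonneg _) hφb' (hrr ▸ hζ1) hψ₀b hcζ t

/-- The constants in the resolvent bounds below. -/
def resolventConst (s : ℝ) : ℕ → ℝ
  | 0 => 1
  -- The first summand is the constant of `LowerBound.of_add_comm`. The second makes the sequence
  -- increasing for every `s ≥ 0`, so that smallness of `η` at the last level implies it at all
  -- earlier ones.
  | k + 1 => (2 + 4 * s * resolventConst s k) + resolventConst s k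

theorem one_le_resolventConst {s : ℝ} (hs : 0 ≤ s) : ∀ k, 1 ≤ resolventConst s k
  | 0 => le_rfl
  | k + 1 => by
    have := one_le_resolventConst hs k
    have h : 0 ≤ s * resolventConst s k := mul_nonneg hs (by linarith)
    rw [resolventConst]
    nlinarith

theorem resolventConst_le_succ {s : ℝ} (hs : 0 ≤ s) (k : ℕ) :
    resolventConst s k ≤ resolventConst s (k + 1) := by
  have := one_le_resolventConst hs k
  have h : 0 ≤ s * resolventConst s k := mul_nonneg hs (by linarith)
  rw [resolventConst]
  nlinarith

/-- If `W + k β ≤ -d` for `k < N` and `W + N β ≥ d`, then `c a + W` is bounded below, provided that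
the commutators of `W + k β` with `a` and `c` are small. -/
theorem lowerBound_of_ladder {β₀ d G S s η : ℝ} (hβ₀ : 0 < β₀)
    (hβs : ∀ u v, ⟪L.β u, v⟫_ℂ = ⟪u, L.β v⟫_ℂ)
    (hβ : ∀ u, β₀ * ‖u‖ ^ 2 ≤ (⟪u, L.β u⟫_ℂ).re) (hd : 0 < d) (hG : 0 ≤ G)
    (hs : 0 ≤ s) (hS : 0 ≤ S) (hsS : d + S ≤ s ^ 2 * β₀) (hη : 0 ≤ η)
    (hGη : G ≤ η * d * √β₀) (N : ℕ) (hηM : 4 * resolventConst s N * η ≤ 1) (W : 𝓗 →L[ℂ] 𝓗)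
    (hWs : ∀ u v, ⟪W u, v⟫_ℂ = ⟪u, W v⟫_ℂ)
    (hWG : ∀ k < N, L.CommBound (W + (k : ℂ) • L.β) G)
    (hWd : ∀ k < N, ∀ u, d * ‖u‖ ^ 2 ≤ -(⟪u, (W + (k : ℂ) • L.β) u⟫_ℂ).re)
    (hWS : ∀ k < N, ∀ u, -(⟪u, (W + (k : ℂ) • L.β) u⟫_ℂ).re ≤ S * ‖u‖ ^ 2)
    (hWN : ∀ u, d * ‖u‖ ^ 2 ≤ (⟪u, (W + (N : ℂ) • L.β) u⟫_ℂ).re) :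
    L.LowerBound W (resolventConst s N / d) := by
  induction N generalizing W with
  | zero =>
    refine lowerBound_of_pos hd fun u => ?_
    simpa using hWN u
  | succ N ih =>
    have e : ∀ k : ℕ, W + L.β + (k : ℂ) • L.β = W + ((k + 1 : ℕ) : ℂ) • L.β := by
      intro k
      push_cast
      rw [add_smul, one_smul]
      abel
    have hM := one_le_resolventConst hs N
    have hMM := resolventConst_le_succ hs N
    have hηM' : 4 * resolventConst s N * η ≤ 1 :=
      (mul_le_mul_of_nonneg_right (by linarith) hη).trans hηM
    -- Replacing `W` by `W + β` shifts all levels by one, so the induction descends from the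
    -- positive level `N` to the level `0`.
    have h := ih hηM' (W + L.β)
      (fun u v => by rw [add_apply, add_apply, inner_add_left, inner_add_right, hWs, hβs])
      (fun k hk => by rw [e]; exact hWG _ (by omega))
      (fun k hk => by rw [e]; exact hWd _ (by omega))
      (fun k hk => by rw [e]; exact hWS _ (by omega))
      (by rw [e]; exact hWN)
    have h0 : W + ((0 : ℕ) : ℂ) • L.β = W := by simp
    have h1 := LowerBound.of_add_comm hβ₀ hβs hβ hd hWs (h0 ▸ hWG 0 (by omega)) hG
      (fun u => by have := hWd 0 (by omega) u; rwa [h0] at this)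
      (fun u => by have := hWS 0 (by omega) u; rwa [h0] at this) hM hs hS hsS hη hηM' hGη h
    intro u f hu
    refine (h1 u f hu).trans ?_
    gcongr
    rw [resolventConst]
    linarith

end LadderPair

end Abstract

/-! ### Convergence of mollifiers in `L²`. -/

section Mollifier

variable {F : Type*} [NormedAddCommGroup F]

/-- Translations are continuous on `L²`. -/
theorem eventually_eLpNorm_translate_sub_le {f : Plane → F} (hf : MemLp f 2 volume) {ε : ENNReal}
    (hε : ε ≠ 0) : ∀ᶠ y in 𝓝 (0 : Plane), eLpNorm (fun x => f (x - y) - f x) 2 volume ≤ ε := by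
  let g : C(Plane, C(Plane, Plane)) :=
    (ContinuousMap.mk (fun p : Plane × Plane => p.2 - p.1) (by fun_prop)).curry
  have hg : ∀ y, MeasurePreserving (g y) (volume : Measure Plane) volume := fun y =>
    measurePreserving_sub_right volume y
  have hc := (continuous_const (y := hf.toLp f)).compMeasurePreservingLp g.continuous hg
    (by norm_num : (2 : ENNReal) ≠ ⊤)
  have ht := hc.tendsto 0
  rw [EMetric.tendsto_nhds] at ht
  filter_upwards [ht ε (pos_iff_ne_zero.2 hε)] with y hy
  rw [Lp.edist_def] at hy
  refine le_of_eq_of_le (eLpNorm_congr_ae ?_) hy.le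
  have h0 : (g 0 : Plane → Plane) = id := by funext x; simp [g]
  have h1 := Lp.coeFn_compMeasurePreserving (hf.toLp f) (hg y)
  have h2 := Lp.coeFn_compMeasurePreserving (hf.toLp f) (hg 0)
  have h3 := hf.coeFn_toLp
  have h4 := (hg y).quasiMeasurePreserving.ae_eq_comp h3
  filter_upwards [h1, h2, h3, h4] with x h1 h2 h3 h4
  rw [Pi.sub_apply, h1, h2, h4, Function.comp_apply, Function.comp_apply, h0, id, h3]
  rfl

variable [NormedSpace ℝ F] [CompleteSpace F]

/-- The left side is the squared norm of the mean of `f (x - y) - f x` for the probability measure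
with density `ρ`; it is at most the mean of the squared norms. -/
theorem enorm_convolution_normed_sub_sq_le {f : Plane → F} (hf : MemLp f 2 volume)
    (hfm : StronglyMeasurable f) (ρ : ContDiffBump (0 : Plane)) (x : Plane) :
    ‖(ρ.normed volume ⋆[ContinuousLinearMap.lsmul ℝ ℝ, volume] f) x - f x‖ₑ ^ 2 ≤
      ∫⁻ y, ENNReal.ofReal (ρ.normed volume y) * ‖f (x - y) - f x‖ₑ ^ 2 := by
  have hρm : Measurable fun y => ENNReal.ofReal (ρ.normed (volume : Measure Plane) y) :=
    (ρ.continuous_normed.measurable).ennreal_ofReal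
  set ν : Measure Plane :=
    volume.withDensity fun y => ENNReal.ofReal (ρ.normed volume y) with hν
  have hprob : IsProbabilityMeasure ν := by
    constructor
    rw [hν, withDensity_apply _ MeasurableSet.univ, Measure.restrict_univ,
      ← ofReal_integral_eq_lintegral_ofReal ρ.integrable_normed
        (Eventually.of_forall ρ.nonneg_normed), ρ.integral_normed, ENNReal.ofReal_one]
  have hhm : StronglyMeasurable fun y => f (x - y) - f x :=
    (hfm.comp_measurable (measurable_const.sub measurable_id)).sub stronglyMeasurable_const
  have hloc : LocallyIntegrable f volume := hf.locallyIntegrable (by norm_num)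
  have hconv : ConvolutionExistsAt (ρ.normed volume) f x (ContinuousLinearMap.lsmul ℝ ℝ) volume :=
    ρ.hasCompactSupport_normed.convolutionExists_left _ ρ.continuous_normed hloc x
  have e1 : (ρ.normed volume ⋆[ContinuousLinearMap.lsmul ℝ ℝ, volume] f) x - f x
      = ∫ y, ρ.normed volume y • (f (x - y) - f x) := by
    have : f x = ∫ y, ρ.normed volume y • f x := by
      rw [integral_smul_const, ρ.integral_normed, one_smul]
    rw [convolution_def]
    conv_lhs => rw [this]
    rw [← integral_sub hconv (ρ.integrable_normed.smul_const _)]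
    simp only [ContinuousLinearMap.lsmul_apply, smul_sub]
  have e2 : ‖∫ y, ρ.normed volume y • (f (x - y) - f x)‖ₑ ≤ ∫⁻ y, ‖f (x - y) - f x‖ₑ ∂ν := by
    refine (enorm_integral_le_lintegral_enorm _).trans (le_of_eq ?_)
    rw [hν, lintegral_withDensity_eq_lintegral_mul _ hρm hhm.enorm]
    congr 1
    funext y
    rw [enorm_smul, Pi.mul_apply, Real.enorm_of_nonneg (ρ.nonneg_normed y)]
  have e3 : (∫⁻ y, ‖f (x - y) - f x‖ₑ ∂ν) ^ 2 ≤ ∫⁻ y, ‖f (x - y) - f x‖ₑ ^ 2 ∂ν := by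
    have h := eLpNorm_le_eLpNorm_of_exponent_le (μ := ν) (p := 1) (q := 2) (by norm_num)
      hhm.aestronglyMeasurable
    rw [eLpNorm_one_eq_lintegral_enorm] at h
    calc _ ≤ (eLpNorm (fun y => f (x - y) - f x) 2 ν) ^ 2 := by gcongr
      _ = _ := by
        have := eLpNorm_nnreal_pow_eq_lintegral (f := fun y => f (x - y) - f x) (μ := ν)
          (p := 2) (by norm_num)
        simpa using this
  rw [e1]
  calc _ ≤ (∫⁻ y, ‖f (x - y) - f x‖ₑ ∂ν) ^ 2 := by gcongr
    _ ≤ _ := e3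
    _ = _ := by
      rw [hν, lintegral_withDensity_eq_lintegral_mul _ hρm (hhm.enorm.pow_const 2)]
      rfl

/-- Mollifiers converge in `L²`. -/
theorem exists_eLpNorm_convolution_sub_le {f : Plane → F} (hf : MemLp f 2 volume)
    (hfm : StronglyMeasurable f) {ε : ENNReal} (hε : ε ≠ 0) :
    ∃ δ > 0, ∀ ρ : ContDiffBump (0 : Plane), ρ.rOut ≤ δ →
      eLpNorm (ρ.normed volume ⋆[ContinuousLinearMap.lsmul ℝ ℝ, volume] f - f) 2 volume ≤ ε := by
  obtain ⟨δ, hδ, hball⟩ := Metric.eventually_nhds_iff.1 (eventually_eLpNorm_translate_sub_le hf hε)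
  refine ⟨δ, hδ, fun ρ hρ => ?_⟩
  have hsq : ∀ h : Plane → F, eLpNorm h 2 volume ^ 2 = ∫⁻ x, ‖h x‖ₑ ^ 2 := by
    intro h
    simpa using eLpNorm_nnreal_pow_eq_lintegral (f := h) (μ := volume) (p := 2) (by norm_num)
  have hmeas : Measurable fun p : Plane × Plane =>
      ENNReal.ofReal (ρ.normed volume p.2) * ‖f (p.1 - p.2) - f p.1‖ₑ ^ 2 := by
    refine Measurable.mul ?_ (Measurable.pow_const (β := ENNReal) ?_ 2)
    · exact (ρ.continuous_normed.measurable.comp measurable_snd).ennreal_ofReal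
    · exact ((hfm.comp_measurable (measurable_fst.sub measurable_snd)).sub
        (hfm.comp_measurable measurable_fst)).enorm
  have key : eLpNorm (ρ.normed volume ⋆[ContinuousLinearMap.lsmul ℝ ℝ, volume] f - f) 2 volume ^ 2
      ≤ ε ^ 2 := by
    rw [hsq]
    -- After Tonelli the inner integral is the squared `L²` distance of `f` to its translate by `y`,
    -- and only `y` in the support of `ρ` matter.
    calc _ ≤ ∫⁻ x, ∫⁻ y, ENNReal.ofReal (ρ.normed volume y) * ‖f (x - y) - f x‖ₑ ^ 2 :=
          lintegral_mono fun x => enorm_convolution_normed_sub_sq_le hf hfm ρ x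
      _ = ∫⁻ y, ∫⁻ x, ENNReal.ofReal (ρ.normed volume y) * ‖f (x - y) - f x‖ₑ ^ 2 :=
          lintegral_lintegral_swap hmeas.aemeasurable
      _ ≤ ∫⁻ y, ENNReal.ofReal (ρ.normed volume y) * ε ^ 2 := by
          refine lintegral_mono fun y => ?_
          rw [lintegral_const_mul' _ _ ENNReal.ofReal_ne_top]
          by_cases hy : y ∈ Function.support (ρ.normed volume)
          · rw [ρ.support_normed_eq] at hy
            rw [← hsq (fun x => f (x - y) - f x)]
            gcongr
            exact hball (lt_of_lt_of_le hy hρ)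
          · rw [Function.notMem_support.1 hy]; simp
      _ = ε ^ 2 := by
          rw [lintegral_mul_const _ (ρ.continuous_normed.measurable.ennreal_ofReal),
            ← ofReal_integral_eq_lintegral_ofReal ρ.integrable_normed
            (Eventually.of_forall ρ.nonneg_normed), ρ.integral_normed, ENNReal.ofReal_one, one_mul]
  exact (ENNReal.pow_le_pow_left_iff two_ne_zero).1 key

end Mollifier

/-! ### The divergence theorem for compactly supported fields. -/

section Divergence

/-- The integral of the divergence of a compactly supported differentiable vector field vanishes,
as soon as the divergence is integrable. -/
theorem integral_divergence_eq_zero (f : Fin 2 → Plane → ℂ) (hd : ∀ i, Differentiable ℝ (f i))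
    (hc : ∀ i, HasCompactSupport (f i))
    (hi : Integrable (fun x => ∑ i, fderiv ℝ (f i) x (e i)) volume) :
    ∫ x, ∑ i, fderiv ℝ (f i) x (e i) = 0 := by
  have hmp := PiLp.volume_preserving_toLp (Fin 2)
  have hme : MeasurableEmbedding (WithLp.toLp 2 : (Fin 2 → ℝ) → Plane) :=
    (MeasurableEquiv.toLp 2 (Fin 2 → ℝ)).measurableEmbedding
  let T : (Fin 2 → ℝ) →L[ℝ] Plane := (EuclideanSpace.equiv (Fin 2) ℝ).symm
  have hT : ∀ y, T y = WithLp.toLp 2 y := fun y => rfl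
  rw [← hmp.integral_comp hme]
  obtain ⟨r, hr⟩ : ∃ r : ℝ, ∀ i x, r ≤ ‖x‖ → f i x = 0 := by
    have h1 : ∀ i, ∃ r : ℝ, ∀ x, r ≤ ‖x‖ → f i x = 0 := by
      intro i
      obtain ⟨r, hr⟩ := (hc i).isCompact.isBounded.exists_norm_le
      refine ⟨r + 1, fun x hx => image_eq_zero_of_notMem_tsupport fun h => ?_⟩
      linarith [hr x h]
    choose r hr using h1
    exact ⟨max (r 0) (r 1), fun i x hx => hr i x (by
      fin_cases i
      · exact (le_max_left _ _).trans hx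
      · exact (le_max_right _ _).trans hx)⟩
  have hr' : ∀ i (y : Fin 2 → ℝ) j, r ≤ |y j| → f i (WithLp.toLp 2 y) = 0 := by
    intro i y j hy
    refine hr i _ (hy.trans ?_)
    simpa using PiLp.norm_apply_le (p := 2) (WithLp.toLp 2 y : Plane) j
  set s : ℝ := |r| + 1
  have hsr : r < s := by linarith [le_abs_self r]
  have hs : 0 < s := by positivity
  set a : Fin 2 → ℝ := fun _ => -s
  set b : Fin 2 → ℝ := fun _ => s
  have hD : ∀ i y, HasFDerivAt (fun y => f i (WithLp.toLp 2 y))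
      ((fderiv ℝ (f i) (WithLp.toLp 2 y)).comp T) y := fun i y =>
    HasFDerivAt.comp y (hd i _).hasFDerivAt T.hasFDerivAt
  have hTe : ∀ i : Fin 2, T (Pi.single i 1) = e i := fun i => by
    rw [hT]
    rfl
  have hi' : Integrable (fun y : Fin 2 → ℝ =>
      ∑ i, fderiv ℝ (f i) (WithLp.toLp 2 y) (e i)) volume :=
    (hmp.integrable_comp_emb hme).2 hi
  -- This form of the theorem asks only for differentiability and integrability of the divergence as
  -- a whole. That matters below: the partial derivatives of `A` need be neither continuous nor
  -- separately integrable.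
  have key := integral_divergence_of_hasFDerivAt_off_countable' a b
    (fun i => by simp only [a, b]; linarith)
    (fun i y => f i (WithLp.toLp 2 y)) (fun i y => (fderiv ℝ (f i) (WithLp.toLp 2 y)).comp T)
    ∅ countable_empty (fun i => (continuous_iff_continuousAt.2
      fun y => (hD i y).continuousAt).continuousOn) (fun y _ i => hD i y) (by
        simp only [ContinuousLinearMap.comp_apply, hTe]
        exact hi'.integrableOn)
  simp only [ContinuousLinearMap.comp_apply, hTe] at key
  rw [← setIntegral_eq_integral_of_forall_compl_eq_zero (s := Icc a b), key]
  · refine Finset.sum_eq_zero fun i _ => ?_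
    rw [setIntegral_eq_zero_of_forall_eq_zero, setIntegral_eq_zero_of_forall_eq_zero, sub_zero]
    · intro y _
      refine hr' i _ i ?_
      simp only [Fin.insertNth_apply_same, a, abs_neg]
      exact hsr.le.trans (le_abs_self _)
    · intro y _
      refine hr' i _ i ?_
      simp only [Fin.insertNth_apply_same, b]
      exact hsr.le.trans (le_abs_self _)
  · intro y hy
    have h1 : ∃ j, s < |y j| := by
      by_contra! h
      exact hy ⟨fun j => (abs_le.1 (h j)).1, fun j => (abs_le.1 (h j)).2⟩
    obtain ⟨j, hj⟩ := h1
    refine Finset.sum_eq_zero fun i _ => ?_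
    have h2 : f i =ᶠ[𝓝 (WithLp.toLp 2 y)] 0 := by
      have h3 : ∀ᶠ x : Plane in 𝓝 (WithLp.toLp 2 y), s < |x j| :=
        (continuous_abs.comp (EuclideanSpace.proj (𝕜 := ℝ) j).continuous).continuousAt.eventually
          (lt_mem_nhds hj)
      filter_upwards [h3] with x hx
      refine hr i x ?_
      have := PiLp.norm_apply_le (p := 2) x j
      rw [Real.norm_eq_abs] at this
      linarith
    rw [h2.fderiv_eq]
    simp

end Divergence

/-! ### Bounded multiplication operators on `L²`. -/

section Multiplication

theorem memLp_bounded_mul {w : Plane → ℂ} {C : ℝ} (hw : Measurable w) (hC : ∀ x, ‖w x‖ ≤ C)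
    (u : L2) : MemLp (fun x => w x * u x) 2 (volume : Measure Plane) := by
  refine (Lp.memLp u).of_le_mul (c := C)
    (hw.aestronglyMeasurable.mul (Lp.aestronglyMeasurable u)) ?_
  filter_upwards with x
  rw [norm_mul]
  exact mul_le_mul_of_nonneg_right (hC x) (norm_nonneg _)

/-- Multiplication by a bounded measurable function on `L²`. -/
def mulL2 (w : Plane → ℂ) (C : ℝ) (hw : Measurable w) (hC : ∀ x, ‖w x‖ ≤ C) : L2 →L[ℂ] L2 :=
  LinearMap.mkContinuous
    { toFun := fun u => (memLp_bounded_mul hw hC u).toLp _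
      map_add' := fun u v => by
        rw [← MemLp.toLp_add]
        apply MemLp.toLp_congr
        filter_upwards [Lp.coeFn_add u v] with x hx
        rw [hx]
        simp [mul_add]
      map_smul' := fun c u => by
        rw [RingHom.id_apply, ← MemLp.toLp_const_smul]
        apply MemLp.toLp_congr
        filter_upwards [Lp.coeFn_smul c u] with x hx
        rw [hx]
        simp [mul_left_comm] }
    C (fun u => by
      have h := (memLp_bounded_mul hw hC u).coeFn_toLp
      refine Lp.norm_le_mul_norm_of_ae_le_mul ?_
      filter_upwards [h] with x hx
      simp only [LinearMap.coe_mk, AddHom.coe_mk]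
      rw [hx, norm_mul]
      exact mul_le_mul_of_nonneg_right (hC x) (norm_nonneg _))

variable {w : Plane → ℂ} {C : ℝ} {hw : Measurable w} {hC : ∀ x, ‖w x‖ ≤ C}

theorem coeFn_mulL2 (u : L2) : mulL2 w C hw hC u =ᵐ[volume] fun x => w x * u x :=
  (memLp_bounded_mul hw hC u).coeFn_toLp

theorem norm_mulL2_le (u : L2) : ‖mulL2 w C hw hC u‖ ≤ C * ‖u‖ := by
  refine Lp.norm_le_mul_norm_of_ae_le_mul ?_
  filter_upwards [coeFn_mulL2 (hw := hw) (hC := hC) u] with x hx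
  rw [hx, norm_mul]
  exact mul_le_mul_of_nonneg_right (hC x) (norm_nonneg _)

theorem inner_eq_integral (u v : L2) : ⟪u, v⟫_ℂ = ∫ x, v x * conj (u x) := by
  rw [L2.inner_def]
  rfl

/-- Multiplication by a bounded continuous function as a bounded operator. -/
def potentialCLM (V : Plane →ᵇ ℝ) : L2 →L[ℂ] L2 :=
  mulL2 (fun x => (V x : ℂ)) ‖V‖ (Complex.continuous_ofReal.comp V.continuous).measurable
    (fun x => by rw [Complex.norm_real]; exact V.norm_coe_le_norm x)

theorem coeFn_potentialCLM (V : Plane →ᵇ ℝ) (u : L2) :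
    potentialCLM V u =ᵐ[volume] fun x => (V x : ℂ) * u x := coeFn_mulL2 u

theorem inner_potentialCLM_symm (V : Plane →ᵇ ℝ) (u v : L2) :
    ⟪potentialCLM V u, v⟫_ℂ = ⟪u, potentialCLM V v⟫_ℂ := by
  rw [inner_eq_integral, inner_eq_integral]
  apply integral_congr_ae
  filter_upwards [coeFn_potentialCLM V u, coeFn_potentialCLM V v] with x hx hy
  rw [hx, hy, map_mul, Complex.conj_ofReal]
  ring

theorem re_inner_potentialCLM (V : Plane →ᵇ ℝ) (u : L2) :
    (⟪u, potentialCLM V u⟫_ℂ).re = ∫ x, V x * ‖u x‖ ^ 2 := by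
  have h : ⟪u, potentialCLM V u⟫_ℂ = ∫ x, ((V x * ‖u x‖ ^ 2 : ℝ) : ℂ) := by
    rw [inner_eq_integral]
    apply integral_congr_ae
    filter_upwards [coeFn_potentialCLM V u] with x hx
    rw [hx, mul_assoc, Complex.mul_conj, Complex.normSq_eq_norm_sq]
    push_cast
    rfl
  rw [h, integral_complex_ofReal, Complex.ofReal_re]

theorem norm_sq_eq_integral (u : L2) : ‖u‖ ^ 2 = ∫ x, ‖u x‖ ^ 2 := by
  rw [← inner_self_eq_norm_sq (𝕜 := ℂ) u, L2.inner_def]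
  simp only [inner_self_eq_norm_sq_to_K]
  have : ∀ x : Plane, ((‖u x‖ : ℂ) ^ 2) = ((‖u x‖ ^ 2 : ℝ) : ℂ) := fun x => by push_cast; rfl
  change (∫ x, ((‖u x‖ : ℂ) ^ 2)).re = _
  simp only [this]
  rw [integral_complex_ofReal, Complex.ofReal_re]

theorem integrable_mul_norm_sq (V : Plane →ᵇ ℝ) (u : L2) :
    Integrable (fun x => V x * ‖u x‖ ^ 2) (volume : Measure Plane) :=
  ((Lp.memLp u).integrable_norm_pow two_ne_zero).bdd_mul V.continuous.aestronglyMeasurable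
    (Eventually.of_forall V.norm_coe_le_norm)

theorem le_re_inner_potentialCLM {V : Plane →ᵇ ℝ} {m : ℝ} (h : ∀ x, m ≤ V x) (u : L2) :
    m * ‖u‖ ^ 2 ≤ (⟪u, potentialCLM V u⟫_ℂ).re := by
  rw [re_inner_potentialCLM, norm_sq_eq_integral, ← integral_const_mul]
  refine integral_mono (((Lp.memLp u).integrable_norm_pow two_ne_zero).const_mul m)
    (integrable_mul_norm_sq V u) fun x => ?_
  exact mul_le_mul_of_nonneg_right (h x) (by positivity)

theorem re_inner_potentialCLM_le {V : Plane →ᵇ ℝ} {m : ℝ} (h : ∀ x, V x ≤ m) (u : L2) :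
    (⟪u, potentialCLM V u⟫_ℂ).re ≤ m * ‖u‖ ^ 2 := by
  rw [re_inner_potentialCLM, norm_sq_eq_integral, ← integral_const_mul]
  refine integral_mono (integrable_mul_norm_sq V u)
    (((Lp.memLp u).integrable_norm_pow two_ne_zero).const_mul m) fun x => ?_
  exact mul_le_mul_of_nonneg_right (h x) (by positivity)

theorem potentialCLM_add_smul (V W : Plane →ᵇ ℝ) (t : ℝ) :
    potentialCLM (V + t • W) = potentialCLM V + (t : ℂ) • potentialCLM W := by
  ext1 u
  apply Lp.ext
  rw [add_apply, smul_apply]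
  filter_upwards [coeFn_potentialCLM (V + t • W) u, coeFn_potentialCLM V u,
    coeFn_potentialCLM W u, Lp.coeFn_add (potentialCLM V u) ((t : ℂ) • potentialCLM W u),
    Lp.coeFn_smul (t : ℂ) (potentialCLM W u)] with x h1 h2 h3 h4 h5
  rw [h1, h4, Pi.add_apply, h5, Pi.smul_apply, h2, h3]
  simp
  ring

end Multiplication

/-! ### Integration by parts and the commutator on test functions. -/

section TestFunctions

variable {A : C(Plane, Plane)}

theorem dense_range_testToL2 : Dense (LinearMap.range testToL2 : Set L2) := by
  refine (Lp.dense_hasCompactSupport_contDiff (E := Plane) (F := ℂ) (μ := volume)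
    (p := 2) (by norm_num)).mono ?_
  rintro f ⟨g, hfg, hgc, hgs⟩
  let φ : Test := ⟨g, hgs, hgc, fun x _ => mem_univ x⟩
  refine ⟨φ, Lp.ext ?_⟩
  exact ((memLp_test φ).coeFn_toLp).trans hfg.symm

theorem ext_of_forall_inner_test {u v : L2}
    (h : ∀ φ : Test, ⟪testToL2 φ, u⟫_ℂ = ⟪testToL2 φ, v⟫_ℂ) : u = v := by
  refine dense_range_testToL2.eq_of_inner_right (𝕜 := ℂ) ?_
  rintro v ⟨φ, rfl⟩
  exact h φ

theorem differentiable_test (φ : Test) : Differentiable ℝ φ := φ.contDiff.differentiable (by simp)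

theorem continuous_fderiv_test (φ : Test) (v : Plane) : Continuous fun x => fderiv ℝ φ x v :=
  (φ.contDiff.continuous_fderiv (by simp)).clm_apply continuous_const

theorem continuous_component (A : C(Plane, Plane)) (j : Fin 2) : Continuous fun x => A x j :=
  (EuclideanSpace.proj (𝕜 := ℝ) j).continuous.comp A.continuous

theorem continuous_momentumFun (φ : Test) (j : Fin 2) :
    Continuous fun x => momentumFun A φ x j := by
  simp only [momentumFun]
  exact (continuous_const.mul (continuous_fderiv_test φ _)).sub
      ((Complex.continuous_ofReal.comp (continuous_component A j)).mul φ.continuous)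

theorem hasFDerivAt_conj_test (φ : Test) (x : Plane) :
    HasFDerivAt (fun x => conj (φ x))
      ((Complex.conjCLE : ℂ →L[ℝ] ℂ).comp (fderiv ℝ φ x)) x :=
  (Complex.conjCLE : ℂ →L[ℝ] ℂ).hasFDerivAt.comp x (differentiable_test φ x).hasFDerivAt

theorem hasCompactSupport_conj_test (φ : Test) : HasCompactSupport fun x => conj (φ x) :=
  φ.hasCompactSupport.comp_left (g := fun z : ℂ => conj z) (map_zero _)

/-- The linear functional `(z₀, z₁) ↦ z₀ + σ z₁`. -/
def ladderCLM (σ : ℂ) : EuclideanSpace ℂ (Fin 2) →L[ℂ] ℂ :=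
  EuclideanSpace.proj 0 + σ • EuclideanSpace.proj 1

theorem ladderCLM_apply (σ : ℂ) (z : EuclideanSpace ℂ (Fin 2)) : ladderCLM σ z = z 0 + σ * z 1 :=
  rfl

/-- `(u₀, u₁) ↦ u₀ + σ u₁` from `L²(ℝ²; ℂ²)` to `L²(ℝ²)`. -/
def ladderL2 (σ : ℂ) : L2Vec →L[ℂ] L2 := (ladderCLM σ).compLpL 2 volume

/-- `π₁ φ + σ π₂ φ` for a test function `φ`. -/
def ladderFun (A : C(Plane, Plane)) (σ : ℂ) (φ : Test) (x : Plane) : ℂ :=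
  momentumFun A φ x 0 + σ * momentumFun A φ x 1

theorem continuous_ladderFun (σ : ℂ) (φ : Test) : Continuous (ladderFun A σ φ) :=
  (continuous_momentumFun φ 0).add (continuous_const.mul (continuous_momentumFun φ 1))

theorem coeFn_momentumTest (φ : Test) : momentumTest A φ =ᵐ[volume] momentumFun A φ :=
  (memLp_momentumFun A φ).coeFn_toLp

theorem coeFn_testToL2 (φ : Test) : testToL2 φ =ᵐ[volume] φ := (memLp_test φ).coeFn_toLp

theorem coeFn_ladder (σ : ℂ) (φ : Test) :
    ladderL2 σ (momentumTest A φ) =ᵐ[volume] ladderFun A σ φ := by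
  filter_upwards [(ladderCLM σ).coeFn_compLpL (momentumTest A φ), coeFn_momentumTest φ]
    with x h1 h2
  rw [ladderL2, h1, h2]
  rfl

theorem inner_testToL2 (φ : Test) (g : L2) : ⟪testToL2 φ, g⟫_ℂ = ∫ x, g x * conj (φ x) := by
  rw [inner_eq_integral]
  apply integral_congr_ae
  filter_upwards [coeFn_testToL2 φ] with x hx
  rw [hx]

theorem inner_ladder (σ : ℂ) (φ : Test) (g : L2) :
    ⟪ladderL2 σ (momentumTest A φ), g⟫_ℂ = ∫ x, g x * conj (ladderFun A σ φ x) := by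
  rw [inner_eq_integral]
  apply integral_congr_ae
  filter_upwards [coeFn_ladder σ φ] with x hx
  rw [hx]

theorem hasCompactSupport_momentumFun (φ : Test) (j : Fin 2) :
    HasCompactSupport fun x => momentumFun A φ x j := by
  apply HasCompactSupport.intro φ.hasCompactSupport
  intro x hx
  have h0 : φ x = 0 := image_eq_zero_of_notMem_tsupport hx
  have h1 : fderiv ℝ (φ : Plane → ℂ) x = 0 := fderiv_of_notMem_tsupport ℝ hx
  simp [momentumFun, h0, h1]

theorem integral_fderiv_eq_zero {f : Plane → ℂ} (hd : Differentiable ℝ f)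
    (hc : HasCompactSupport f) (j : Fin 2)
    (hi : Integrable (fun x => fderiv ℝ f x (e j)) volume) : ∫ x, fderiv ℝ f x (e j) = 0 := by
  have key : ∀ x, ∑ i, fderiv ℝ (if i = j then f else 0) x (e i) = fderiv ℝ f x (e j) := by
    intro x
    rw [Finset.sum_eq_single j]
    · simp
    · intro i _ hij
      simp [hij]
    · simp
  have := integral_divergence_eq_zero (fun i => if i = j then f else 0)
    (fun i => by split_ifs <;> [exact hd; exact differentiable_const _])
    (fun i => by split_ifs <;> [exact hc; exact HasCompactSupport.zero])
    (by simpa only [key] using hi)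
  simpa only [key] using this

/-- Integration by parts against a test function multiplied by a function of bounded gradient. -/
theorem integral_mul_conj_momentumFun (φ ψ : Test) {W : Plane → ℝ} (hW : HasBoundedGradient W)
    (j : Fin 2) :
    Integrable (fun x => W x * ψ x * starRingEnd ℂ (momentumFun A φ x j)) volume ∧
    Integrable (fun x => (W x * momentumFun A ψ x j - Complex.I * fderiv ℝ W x (e j) * ψ x)
        * conj (φ x)) volume ∧
    ∫ x, W x * ψ x * starRingEnd ℂ (momentumFun A φ x j) =
      ∫ x, (W x * momentumFun A ψ x j - Complex.I * fderiv ℝ W x (e j) * ψ x) * conj (φ x) := by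
  obtain ⟨hWd, G, hG⟩ := hW
  have hWc : Continuous fun x => (W x : ℂ) := Complex.continuous_ofReal.comp hWd.continuous
  have hφc : Continuous fun x => conj (φ x) := Complex.continuous_conj.comp φ.continuous
  have hWD : ∀ x, HasFDerivAt (fun x => (W x : ℂ))
      ((Complex.ofRealCLM).comp (fderiv ℝ W x)) x := fun x =>
    Complex.ofRealCLM.hasFDerivAt.comp x (hWd x).hasFDerivAt
  have hD : ∀ x, HasFDerivAt (fun x => (W x : ℂ) * ψ x * conj (φ x)) _ x := fun x =>
    ((hWD x).mul (differentiable_test ψ x).hasFDerivAt).mul (hasFDerivAt_conj_test φ x)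
  have hcs : HasCompactSupport fun x => (W x : ℂ) * ψ x * conj (φ x) :=
    (hasCompactSupport_conj_test φ).mul_left
  have i1 : Integrable (fun x => W x * ψ x * starRingEnd ℂ (momentumFun A φ x j)) volume :=
    ((hWc.mul ψ.continuous).mul (Complex.continuous_conj.comp
      (continuous_momentumFun φ j))).integrable_of_hasCompactSupport
      (ψ.hasCompactSupport.mul_left.mul_right)
  have i2 : Integrable (fun x => (W x * momentumFun A ψ x j) * conj (φ x)) volume :=
    ((hWc.mul (continuous_momentumFun ψ j)).mul hφc).integrable_of_hasCompactSupport
      ((hasCompactSupport_conj_test φ).mul_left)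
  have i3 : Integrable (fun x => Complex.I * fderiv ℝ W x (e j) * (ψ x * conj (φ x))) volume := by
    refine Integrable.bdd_mul (c := G) ((ψ.continuous.mul hφc).integrable_of_hasCompactSupport
      ((hasCompactSupport_conj_test φ).mul_left)) ?_ (Eventually.of_forall fun x => ?_)
    · exact (measurable_const.mul (Complex.measurable_ofReal.comp
        (measurable_fderiv_apply_const ℝ W (e j)))).aestronglyMeasurable
    · rw [norm_mul, Complex.norm_I, one_mul, Complex.norm_real]
      refine ((fderiv ℝ W x).le_opNorm _).trans ?_
      simpa using hG (mem_range_self x)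
  have i4 : Integrable (fun x => (W x * momentumFun A ψ x j - Complex.I * fderiv ℝ W x (e j) * ψ x)
        * conj (φ x)) volume := by
    refine (i2.sub i3).congr (Eventually.of_forall fun x => ?_)
    simp only [Pi.sub_apply]
    ring
  refine ⟨i1, i4, ?_⟩
  have key : ∀ x, W x * ψ x * starRingEnd ℂ (momentumFun A φ x j) -
      (W x * momentumFun A ψ x j - Complex.I * fderiv ℝ W x (e j) * ψ x) * conj (φ x)
      = Complex.I * fderiv ℝ (fun x => (W x : ℂ) * ψ x * conj (φ x)) x (e j) := by
    intro x
    rw [(hD x).fderiv]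
    simp [momentumFun]
    ring
  -- By `key` this derivative is a combination of functions already known to be integrable, although
  -- `∇W` is merely bounded and measurable.
  have i5 : Integrable
      (fun x => fderiv ℝ (fun x => (W x : ℂ) * ψ x * conj (φ x)) x (e j)) volume := by
    refine ((i1.sub i4).const_mul (-Complex.I)).congr (Eventually.of_forall fun x => ?_)
    simp only [Pi.sub_apply]
    rw [key, ← mul_assoc]
    simp
  rw [← sub_eq_zero, ← integral_sub i1 i4]
  simp only [key]
  rw [integral_const_mul, integral_fderiv_eq_zero (fun x => (hD x).differentiableAt) hcs j i5,
    mul_zero]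

/-- The commutator `[π₁, π₂] = i B` in the sense of forms on test functions. -/
theorem integral_commutator {B : Plane → ℝ} (hA : IsVectorPotential A B) (hB : Continuous B)
    (φ ψ : Test) :
    ∫ x, (momentumFun A ψ x 1 * starRingEnd ℂ (momentumFun A φ x 0)
        - momentumFun A ψ x 0 * starRingEnd ℂ (momentumFun A φ x 1))
      = ∫ x, Complex.I * (B x * ψ x * conj (φ x)) := by
  obtain ⟨hAd, hcurl⟩ := hA
  have hφc : Continuous fun x => conj (φ x) := Complex.continuous_conj.comp φ.continuous
  have hAD : ∀ j x, HasFDerivAt (fun x => (A x j : ℂ))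
      (Complex.ofRealCLM.comp ((EuclideanSpace.proj (𝕜 := ℝ) j).comp (fderiv ℝ A x))) x :=
    fun j x => Complex.ofRealCLM.hasFDerivAt.comp x
      ((EuclideanSpace.proj (𝕜 := ℝ) j).hasFDerivAt.comp x (hAd x).hasFDerivAt)
  have hψ2 : Differentiable ℝ (fderiv ℝ (ψ : Plane → ℂ)) :=
    (ψ.contDiff.fderiv_right (m := 1) (by norm_cast)).differentiable (by simp)
  have hψD : ∀ j x, HasFDerivAt (fun x => fderiv ℝ ψ x (e j))
      ((ContinuousLinearMap.apply ℝ ℂ (e j)).comp (fderiv ℝ (fderiv ℝ (ψ : Plane → ℂ)) x)) x :=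
    fun j x => (ContinuousLinearMap.apply ℝ ℂ (e j)).hasFDerivAt.comp x (hψ2 x).hasFDerivAt
  have hsymm : ∀ x, fderiv ℝ (fderiv ℝ (ψ : Plane → ℂ)) x (e 0) (e 1)
      = fderiv ℝ (fderiv ℝ (ψ : Plane → ℂ)) x (e 1) (e 0) := fun x =>
    (ψ.contDiff.contDiffAt.isSymmSndFDerivAt
      (by
        rw [minSmoothness_of_isRCLikeNormedField]
        exact WithTop.coe_le_coe.2 (le_top : (2 : ℕ∞) ≤ ⊤))) (e 0) (e 1)
  have hX : ∀ j x, HasFDerivAt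
      (fun x => (fderiv ℝ ψ x (e j) - Complex.I * (A x j * ψ x)) * conj (φ x)) _ x := fun j x =>
    ((hψD j x).sub (((hAD j x).mul (differentiable_test ψ x).hasFDerivAt).const_mul
      Complex.I)).mul (hasFDerivAt_conj_test φ x)
  -- With `D_j = ∂_j - i A_j`, so that `π_j = -i D_j`, the field is `(D₂ψ φ̄, -D₁ψ φ̄)`. In its
  -- divergence the second derivatives of `ψ` cancel and those of `A` combine to the curl `B`, which
  -- is continuous; so the divergence is integrable.
  set X : Fin 2 → Plane → ℂ := ![fun x => (fderiv ℝ ψ x (e 1) - Complex.I * (A x 1 * ψ x))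
    * conj (φ x), fun x => -((fderiv ℝ ψ x (e 0) - Complex.I * (A x 0 * ψ x)) * conj (φ x))]
    with hXdef
  have hd : ∀ i, Differentiable ℝ (X i) := by
    intro i
    fin_cases i
    · exact fun x => (hX 1 x).differentiableAt
    · exact fun x => (hX 0 x).neg.differentiableAt
  have hc : ∀ i, HasCompactSupport (X i) := by
    intro i
    fin_cases i
    · exact (hasCompactSupport_conj_test φ).mul_left
    · exact HasCompactSupport.neg ((hasCompactSupport_conj_test φ).mul_left)
  have key : ∀ x, ∑ i, fderiv ℝ (X i) x (e i) = (momentumFun A ψ x 1 * starRingEnd ℂ (momentumFun A φ x 0)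
        - momentumFun A ψ x 0 * starRingEnd ℂ (momentumFun A φ x 1))
      - Complex.I * (B x * ψ x * conj (φ x)) := by
    intro x
    rw [Fin.sum_univ_two]
    simp only [hXdef, Matrix.cons_val_zero, Matrix.cons_val_one]
    rw [(hX 1 x).fderiv, fderiv_fun_neg, (hX 0 x).fderiv, ← hcurl x]
    have := hsymm x
    simp [momentumFun, this]
    ring_nf
    simp only [Complex.I_sq]
    ring
  have i1 : ∀ j k, Integrable (fun x => momentumFun A ψ x j * starRingEnd ℂ (momentumFun A φ x k)) volume :=
    fun j k => ((continuous_momentumFun ψ j).mul (Complex.continuous_conj.comp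
      (continuous_momentumFun φ k))).integrable_of_hasCompactSupport
      (hasCompactSupport_momentumFun ψ j).mul_right
  have i2 : Integrable (fun x => Complex.I * (B x * ψ x * conj (φ x))) volume :=
    (continuous_const.mul (((Complex.continuous_ofReal.comp hB).mul
      ψ.continuous).mul hφc)).integrable_of_hasCompactSupport
      ((hasCompactSupport_conj_test φ).mul_left.mul_left)
  have h := integral_divergence_eq_zero X hd hc (by
    simp only [key]
    exact ((i1 1 0).sub (i1 0 1)).sub i2)
  simp only [key] at h
  have i3 : Integrable (fun x => momentumFun A ψ x 1 * starRingEnd ℂ (momentumFun A φ x 0)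
      - momentumFun A ψ x 0 * starRingEnd ℂ (momentumFun A φ x 1)) volume := (i1 1 0).sub (i1 0 1)
  rwa [integral_sub i3 i2, sub_eq_zero] at h

end TestFunctions

/-! ### Friedrichs mollification of weak ladder derivatives. -/

section WeakStrong

variable {A : C(Plane, Plane)} {σ : ℂ}

theorem fderiv_convolution_normed (ρ : ContDiffBump (0 : Plane)) {f : Plane → ℂ}
    (hf : LocallyIntegrable f volume) (x v : Plane) :
    fderiv ℝ (ρ.normed volume ⋆[ContinuousLinearMap.lsmul ℝ ℝ, volume] f) x v
      = ∫ t, (fderiv ℝ (ρ.normed volume) (x - t) v : ℂ) * f t := by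
  have h := (ρ.hasCompactSupport_normed (μ := (volume : Measure Plane))).hasFDerivAt_convolution_left
    (ContinuousLinearMap.lsmul ℝ ℝ : ℝ →L[ℝ] ℂ →L[ℝ] ℂ) (μ := (volume : Measure Plane))
    (ρ.contDiff_normed (n := 1)) hf x
  have hex : ConvolutionExistsAt (fderiv ℝ (ρ.normed (volume : Measure Plane))) f x
      (ContinuousLinearMap.precompL Plane (ContinuousLinearMap.lsmul ℝ ℝ : ℝ →L[ℝ] ℂ →L[ℝ] ℂ))
      volume :=
    HasCompactSupport.convolutionExists_left _
      ((ρ.hasCompactSupport_normed (μ := (volume : Measure Plane))).fderiv ℝ)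
      ((ρ.contDiff_normed (n := 1) (μ := (volume : Measure Plane))).continuous_fderiv (by simp))
      hf x
  rw [h.fderiv, convolution_eq_swap, ContinuousLinearMap.integral_apply hex.integrable_swap]
  congr 1

/-- The test function `t ↦ ρ (x - t)`. -/
def shiftedBump (ρ : ContDiffBump (0 : Plane)) (x : Plane) : Test where
  toFun t := (ρ.normed volume (x - t) : ℂ)
  contDiff' := Complex.ofRealCLM.contDiff.comp
    (ρ.contDiff_normed.comp (contDiff_const.sub contDiff_id))
  hasCompactSupport' := by
    have h : HasCompactSupport fun t => ρ.normed (volume : Measure Plane) (x - t) :=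
      ρ.hasCompactSupport_normed.comp_homeomorph (Homeomorph.subLeft x)
    exact h.comp_left Complex.ofReal_zero
  tsupport_subset' := fun x _ => mem_univ x

theorem shiftedBump_apply (ρ : ContDiffBump (0 : Plane)) (x t : Plane) :
    shiftedBump ρ x t = (ρ.normed volume (x - t) : ℂ) := rfl

theorem fderiv_shiftedBump (ρ : ContDiffBump (0 : Plane)) (x t v : Plane) :
    fderiv ℝ (shiftedBump ρ x) t v = -(fderiv ℝ (ρ.normed volume) (x - t) v : ℂ) := by
  have h1 : HasFDerivAt (fun t : Plane => x - t) (-ContinuousLinearMap.id ℝ Plane) t := by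
    exact (hasFDerivAt_id t).const_sub x
  have h2 : HasFDerivAt (ρ.normed (volume : Measure Plane))
      (fderiv ℝ (ρ.normed volume) (x - t)) (x - t) :=
    ((ρ.contDiff_normed (n := 1)).differentiable (by simp) _).hasFDerivAt
  have h3 : HasFDerivAt (shiftedBump ρ x) _ t :=
    Complex.ofRealCLM.hasFDerivAt.comp t (h2.comp t h1)
  rw [h3.fderiv]
  simp

theorem conj_ladderFun_shiftedBump (ρ : ContDiffBump (0 : Plane)) (x t : Plane) :
    conj (ladderFun A (conj σ) (shiftedBump ρ x) t) =
      -Complex.I * ((fderiv ℝ (ρ.normed volume) (x - t) (e 0) : ℂ)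
        + σ * (fderiv ℝ (ρ.normed volume) (x - t) (e 1) : ℂ))
      - (A t 0 + σ * A t 1) * (ρ.normed volume (x - t) : ℂ) := by
  simp only [ladderFun, momentumFun, fderiv_shiftedBump, shiftedBump_apply]
  simp
  ring

/-- The mollification of a compactly supported function, as a test function. -/
def mollify (ρ : ContDiffBump (0 : Plane)) (f : Plane → ℂ) (hf : LocallyIntegrable f volume)
    (hc : HasCompactSupport f) : Test where
  toFun := ρ.normed volume ⋆[ContinuousLinearMap.lsmul ℝ ℝ, volume] f
  contDiff' := ρ.hasCompactSupport_normed.contDiff_convolution_left _ ρ.contDiff_normed hf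
  hasCompactSupport' := ρ.hasCompactSupport_normed.convolution _ hc
  tsupport_subset' := fun x _ => mem_univ x

/-- Test the weak equation with `t ↦ ρ (x - t)`. The potential then enters at `t`, inside the
convolution, whereas differentiating the mollification has it at `x`; the last two terms are the
resulting commutator. -/
theorem ladderFun_mollify (ρ : ContDiffBump (0 : Plane)) {f g : Plane → ℂ}
    (hf : LocallyIntegrable f volume) (hc : HasCompactSupport f)
    (h : ∀ φ : Test, ∫ x, f x * conj (ladderFun A (conj σ) φ x) = ∫ x, g x * conj (φ x))
    (x : Plane) :
    ladderFun A σ (mollify ρ f hf hc) x =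
      (ρ.normed volume ⋆[ContinuousLinearMap.lsmul ℝ ℝ, volume] g) x
      + (ρ.normed volume ⋆[ContinuousLinearMap.lsmul ℝ ℝ, volume]
          fun t => ((A t 0 : ℂ) + σ * A t 1) * f t) x
      - ((A x 0 : ℂ) + σ * A x 1) *
        (ρ.normed volume ⋆[ContinuousLinearMap.lsmul ℝ ℝ, volume] f) x := by
  have hρ1 : Continuous (fderiv ℝ (ρ.normed (volume : Measure Plane))) :=
    (ρ.contDiff_normed (n := 1)).continuous_fderiv (by simp)
  have hfi : Integrable f volume := by
    rw [← integrableOn_iff_integrable_of_support_subset (subset_tsupport f)]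
    exact hf.integrableOn_isCompact hc
  have iD : ∀ j, Integrable
      (fun t => (fderiv ℝ (ρ.normed volume) (x - t) (e j) : ℂ) * f t) volume := by
    intro j
    have hc1 : Continuous fun t => fderiv ℝ (ρ.normed (volume : Measure Plane)) t (e j) :=
      hρ1.clm_apply continuous_const
    obtain ⟨C, hC⟩ := hc1.bounded_above_of_compact_support
      (ρ.hasCompactSupport_normed.fderiv_apply ℝ (e j))
    refine hfi.bdd_mul (c := C) (Complex.continuous_ofReal.comp (hc1.comp
      (continuous_const.sub continuous_id))).aestronglyMeasurable
      (Eventually.of_forall fun t => ?_)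
    rw [Complex.norm_real]
    exact hC _
  have hAc : Continuous fun t => (A t 0 : ℂ) + σ * A t 1 :=
    (Complex.continuous_ofReal.comp (continuous_component A 0)).add
      (continuous_const.mul (Complex.continuous_ofReal.comp (continuous_component A 1)))
  have iA : Integrable (fun t => (ρ.normed volume (x - t) : ℂ) * (((A t 0 : ℂ) + σ * A t 1) * f t))
      volume := by
    have hc2 : Continuous fun t => (ρ.normed volume (x - t) : ℂ) * ((A t 0 : ℂ) + σ * A t 1) :=
      (shiftedBump ρ x).continuous.mul hAc
    obtain ⟨C, hC⟩ := hc2.bounded_above_of_compact_support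
      ((shiftedBump ρ x).hasCompactSupport.mul_right)
    refine (hfi.bdd_mul (c := C) hc2.aestronglyMeasurable
      (Eventually.of_forall hC)).congr (Eventually.of_forall fun t => ?_)
    simp only
    ring
  have hx := h (shiftedBump ρ x)
  have e1 : ∫ t, g t * conj (shiftedBump ρ x t)
      = (ρ.normed volume ⋆[ContinuousLinearMap.lsmul ℝ ℝ, volume] g) x := by
    rw [convolution_eq_swap]
    congr 1
    funext t
    rw [shiftedBump_apply, Complex.conj_ofReal, mul_comm]
    simp
  have e2 : ∫ t, f t * conj (ladderFun A (conj σ) (shiftedBump ρ x) t) =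
      -Complex.I * ((∫ t, (fderiv ℝ (ρ.normed volume) (x - t) (e 0) : ℂ) * f t)
        + σ * ∫ t, (fderiv ℝ (ρ.normed volume) (x - t) (e 1) : ℂ) * f t)
      - (ρ.normed volume ⋆[ContinuousLinearMap.lsmul ℝ ℝ, volume]
          fun t => ((A t 0 : ℂ) + σ * A t 1) * f t) x := by
    rw [convolution_eq_swap]
    simp only [ContinuousLinearMap.lsmul_apply, Complex.real_smul]
    have iDD : Integrable (fun t => -Complex.I *
        ((fderiv ℝ (ρ.normed volume) (x - t) (e 0) : ℂ) * f t
          + σ * ((fderiv ℝ (ρ.normed volume) (x - t) (e 1) : ℂ) * f t))) volume :=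
      ((iD 0).add ((iD 1).const_mul σ)).const_mul _
    rw [← integral_const_mul σ, ← integral_add (iD 0) ((iD 1).const_mul σ), ← integral_const_mul,
      ← integral_sub iDD iA]
    congr 1
    funext t
    rw [conj_ladderFun_shiftedBump]
    ring
  have e3 : ladderFun A σ (mollify ρ f hf hc) x =
      -Complex.I * ((∫ t, (fderiv ℝ (ρ.normed volume) (x - t) (e 0) : ℂ) * f t)
        + σ * ∫ t, (fderiv ℝ (ρ.normed volume) (x - t) (e 1) : ℂ) * f t)
      - ((A x 0 : ℂ) + σ * A x 1) *
        (ρ.normed volume ⋆[ContinuousLinearMap.lsmul ℝ ℝ, volume] f) x := by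
    rw [← fderiv_convolution_normed ρ hf, ← fderiv_convolution_normed ρ hf]
    simp only [ladderFun, momentumFun]
    change (-Complex.I * fderiv ℝ (ρ.normed volume ⋆[ContinuousLinearMap.lsmul ℝ ℝ, volume] f) x
      (e 0) - (A x 0 : ℂ) * (ρ.normed volume ⋆[ContinuousLinearMap.lsmul ℝ ℝ, volume] f) x) +
      σ * (-Complex.I * fderiv ℝ (ρ.normed volume ⋆[ContinuousLinearMap.lsmul ℝ ℝ, volume] f) x
      (e 1) - (A x 1 : ℂ) * (ρ.normed volume ⋆[ContinuousLinearMap.lsmul ℝ ℝ, volume] f) x) = _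
    ring
  rw [e1, e2] at hx
  rw [e3, ← hx]
  ring

/-- Friedrichs' lemma: a compactly supported function whose weak derivative is square integrable is
approximated by test functions in the graph norm. -/
theorem exists_test_approx_of_compactSupport {f g : Plane → ℂ} (hf : MemLp f 2 volume)
    (hfm : StronglyMeasurable f) (hc : HasCompactSupport f) (hg : MemLp g 2 volume)
    (hgm : StronglyMeasurable g)
    (h : ∀ φ : Test, ∫ x, f x * conj (ladderFun A (conj σ) φ x) = ∫ x, g x * conj (φ x))
    {ε : ℝ} (hε : 0 < ε) :
    ∃ φ : Test, eLpNorm (⇑φ - f) 2 volume ≤ ENNReal.ofReal ε ∧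
      eLpNorm (ladderFun A σ φ - g) 2 volume ≤ ENNReal.ofReal ε := by
  have hloc : LocallyIntegrable f volume := hf.locallyIntegrable (by norm_num)
  set a : Plane → ℂ := fun t => (A t 0 : ℂ) + σ * A t 1 with ha
  have hac : Continuous a :=
    (Complex.continuous_ofReal.comp (continuous_component A 0)).add
      (continuous_const.mul (Complex.continuous_ofReal.comp (continuous_component A 1)))
  obtain ⟨r, hr⟩ := hc.isCompact.isBounded.exists_norm_le
  obtain ⟨C, hC⟩ := (isCompact_closedBall (0 : Plane) (r + 1)).exists_bound_of_continuousOn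
    hac.continuousOn
  have hf0 : ∀ x, r < ‖x‖ → f x = 0 := fun x hx =>
    image_eq_zero_of_notMem_tsupport fun h => absurd (hr x h) (not_le.2 hx)
  -- A bound for the coefficient on the ball containing the support of `f` and of its mollification,
  -- as the mollifier has radius at most `1`. Being at least `1`, it makes `η ≤ ε / 3`.
  set C' : ℝ := max C 1
  have hC'pos : 0 < C' := lt_of_lt_of_le one_pos (le_max_right _ _)
  have hC' : ∀ x, ‖x‖ ≤ r + 1 → ‖a x‖ ≤ C' := fun x hx =>
    (hC x (by simpa using hx)).trans (le_max_left _ _)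
  have hh : MemLp (fun t => a t * f t) 2 volume := by
    refine hf.of_le_mul (c := C') (hac.aestronglyMeasurable.mul hf.1)
      (Eventually.of_forall fun x => ?_)
    rw [norm_mul]
    by_cases hx : ‖x‖ ≤ r + 1
    · exact mul_le_mul_of_nonneg_right (hC' x hx) (norm_nonneg _)
    · rw [hf0 x (by linarith [not_le.1 hx])]; simp
  have hhm : StronglyMeasurable fun t => a t * f t := hac.stronglyMeasurable.mul hfm
  set η : ℝ := ε / (3 * C') with hη
  have hηpos : 0 < η := by positivity
  have hη3 : η ≤ ε / 3 := by
    rw [hη]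
    exact div_le_div_of_nonneg_left hε.le (by norm_num) (by nlinarith [le_max_right C 1])
  have hη0 : ENNReal.ofReal η ≠ 0 := by simpa using hηpos
  have hε0 : ENNReal.ofReal (ε / 3) ≠ 0 := by simpa using hε
  obtain ⟨δ₁, hδ₁, h1⟩ := exists_eLpNorm_convolution_sub_le hf hfm hη0
  obtain ⟨δ₂, hδ₂, h2⟩ := exists_eLpNorm_convolution_sub_le hg hgm hε0
  obtain ⟨δ₃, hδ₃, h3⟩ := exists_eLpNorm_convolution_sub_le hh hhm hε0
  set δ : ℝ := min 1 (min δ₁ (min δ₂ δ₃)) with hδ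
  have hδpos : 0 < δ := by positivity
  let ρ : ContDiffBump (0 : Plane) := ⟨δ / 2, δ, by positivity, by linarith⟩
  have hρ : ρ.rOut = δ := rfl
  have hρ0 : ρ.rOut ≤ 1 := min_le_left _ _
  specialize h1 ρ ((min_le_right _ _).trans (min_le_left _ _))
  specialize h2 ρ ((min_le_right _ _).trans ((min_le_right _ _).trans (min_le_left _ _)))
  specialize h3 ρ ((min_le_right _ _).trans ((min_le_right _ _).trans (min_le_right _ _)))
  refine ⟨mollify ρ f hloc hc, ?_, ?_⟩
  · exact h1.trans (ENNReal.ofReal_le_ofReal (by linarith))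
  · set Jf := ρ.normed volume ⋆[ContinuousLinearMap.lsmul ℝ ℝ, volume] f with hJf
    have hJf0 : ∀ x, r + 1 < ‖x‖ → Jf x = 0 := by
      intro x hx
      by_contra hne
      have := support_convolution_subset (μ := (volume : Measure Plane))
        (ContinuousLinearMap.lsmul ℝ ℝ : ℝ →L[ℝ] ℂ →L[ℝ] ℂ) (f := ρ.normed volume) (g := f)
        (Function.mem_support.2 hne)
      obtain ⟨y, hy, z, hz, rfl⟩ := this
      rw [ρ.support_normed_eq, mem_ball_zero_iff] at hy
      have hz' := hr z (subset_tsupport f hz)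
      have := norm_add_le y z
      simp only at hx
      linarith
    -- Because `A` enters without derivatives, no cancellation in the commutator is needed: its two
    -- terms both tend to `a f`.
    have e : ladderFun A σ (mollify ρ f hloc hc) - g =
        ((ρ.normed volume ⋆[ContinuousLinearMap.lsmul ℝ ℝ, volume] g) - g)
        + ((ρ.normed volume ⋆[ContinuousLinearMap.lsmul ℝ ℝ, volume] fun t => a t * f t)
          - fun t => a t * f t) - fun x => a x * (Jf - f) x := by
      funext x
      simp only [Pi.sub_apply, Pi.add_apply]
      rw [ladderFun_mollify ρ hloc hc h x]
      ring
    have hmg : AEStronglyMeasurable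
        ((ρ.normed volume ⋆[ContinuousLinearMap.lsmul ℝ ℝ, volume] g) - g) volume :=
      ((ρ.hasCompactSupport_normed.continuous_convolution_left _ ρ.continuous_normed
        (hg.locallyIntegrable (by norm_num))).aestronglyMeasurable).sub hg.1
    have hmh : AEStronglyMeasurable
        ((ρ.normed volume ⋆[ContinuousLinearMap.lsmul ℝ ℝ, volume] fun t => a t * f t)
          - fun t => a t * f t) volume :=
      ((ρ.hasCompactSupport_normed.continuous_convolution_left _ ρ.continuous_normed
        (hh.locallyIntegrable (by norm_num))).aestronglyMeasurable).sub hh.1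
    have hmf : AEStronglyMeasurable (fun x => a x * (Jf - f) x) volume :=
      hac.aestronglyMeasurable.mul
        (((ρ.hasCompactSupport_normed.continuous_convolution_left _ ρ.continuous_normed
        hloc).aestronglyMeasurable).sub hf.1)
    have h4 : eLpNorm (fun x => a x * (Jf - f) x) 2 volume ≤ ENNReal.ofReal (ε / 3) := by
      have := eLpNorm_le_mul_eLpNorm_of_ae_le_mul (μ := volume) (p := 2) (c := C')
        (f := fun x => a x * (Jf - f) x) (g := Jf - f) (Eventually.of_forall fun x => by
          rw [norm_mul]
          by_cases hx : ‖x‖ ≤ r + 1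
          · exact mul_le_mul_of_nonneg_right (hC' x hx) (norm_nonneg _)
          · rw [Pi.sub_apply, hf0 x (by linarith [not_le.1 hx]), hJf0 x (not_le.1 hx)]; simp)
      refine this.trans ((mul_le_mul_right h1 _).trans ?_)
      rw [← ENNReal.ofReal_mul hC'pos.le]
      refine ENNReal.ofReal_le_ofReal (le_of_eq ?_)
      rw [hη]
      field_simp
    rw [e]
    calc _ ≤ ENNReal.ofReal (ε / 3) + ENNReal.ofReal (ε / 3) + ENNReal.ofReal (ε / 3) := by
          refine (eLpNorm_sub_le (hmg.add hmh) hmf (by norm_num)).trans (add_le_add ?_ h4)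
          exact (eLpNorm_add_le hmg hmh (by norm_num)).trans (add_le_add h2 h3)
      _ = ENNReal.ofReal ε := by
          rw [← ENNReal.ofReal_add (by positivity) (by positivity),
            ← ENNReal.ofReal_add (by positivity) (by positivity)]
          congr 1
          ring

end WeakStrong

/-! ### Cutoffs at infinity. -/

section Cutoff

/-- A smooth function which is `1` on the ball of radius `R` and vanishes outside the ball of
radius `2 R`. -/
def cutoff (R : ℝ) (x : Plane) : ℝ :=
  (⟨1, 2, one_pos, one_lt_two⟩ : ContDiffBump (0 : Plane)) (R⁻¹ • x)

theorem contDiff_cutoff (R : ℝ) : ContDiff ℝ ∞ (cutoff R) :=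
  ContDiff.comp (ContDiffBump.contDiff _) (contDiff_const_smul R⁻¹)

theorem hasCompactSupport_cutoff {R : ℝ} (hR : 0 < R) : HasCompactSupport (cutoff R) :=
  (ContDiffBump.hasCompactSupport _).comp_smul (inv_ne_zero hR.ne')

theorem norm_cutoff_le (R : ℝ) (x : Plane) : ‖(cutoff R x : ℂ)‖ ≤ 1 := by
  rw [Complex.norm_real, Real.norm_eq_abs, cutoff, abs_of_nonneg (ContDiffBump.nonneg _)]
  exact ContDiffBump.le_one _

theorem cutoff_eq_one {R : ℝ} (hR : 0 < R) {x : Plane} (hx : ‖x‖ ≤ R) : cutoff R x = 1 := by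
  refine ContDiffBump.one_of_mem_closedBall _ ?_
  rw [mem_closedBall_zero_iff, norm_smul, norm_inv, Real.norm_eq_abs, abs_of_pos hR,
    inv_mul_le_iff₀ hR]
  simpa using hx

theorem exists_norm_fderiv_cutoff_le :
    ∃ C : ℝ, 0 ≤ C ∧ ∀ R : ℝ, 0 < R → ∀ x, ‖fderiv ℝ (cutoff R) x‖ ≤ C / R := by
  let b : ContDiffBump (0 : Plane) := ⟨1, 2, one_pos, one_lt_two⟩
  have hc : Continuous (fderiv ℝ b) := (b.contDiff (n := 1)).continuous_fderiv (by simp)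
  obtain ⟨C, hC⟩ := hc.bounded_above_of_compact_support (b.hasCompactSupport.fderiv ℝ)
  refine ⟨C, (norm_nonneg _).trans (hC 0), fun R hR x => ?_⟩
  have h : HasFDerivAt (cutoff R)
      ((fderiv ℝ b (R⁻¹ • x)).comp (R⁻¹ • ContinuousLinearMap.id ℝ Plane)) x :=
    HasFDerivAt.comp x (((b.contDiff (n := 1)).differentiable (by simp) _).hasFDerivAt)
      ((hasFDerivAt_id x).const_smul R⁻¹)
  rw [h.fderiv, ContinuousLinearMap.comp_smul, ContinuousLinearMap.comp_id, norm_smul, norm_inv,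
    Real.norm_eq_abs, abs_of_pos hR, inv_mul_eq_div]
  exact div_le_div_of_nonneg_right (hC _) hR.le

/-- Multiplication by the cutoff. -/
def cutoffCLM (R : ℝ) : L2 →L[ℂ] L2 :=
  mulL2 (fun x => (cutoff R x : ℂ)) 1
    (Complex.continuous_ofReal.comp (contDiff_cutoff R).continuous).measurable (norm_cutoff_le R)

/-- Cutoffs have norm at most `1` and eventually fix each test function; test functions are dense.
-/
theorem eventually_norm_cutoffCLM_sub_le (u : L2) {ε : ℝ} (hε : 0 < ε) :
    ∀ᶠ R in atTop, ‖cutoffCLM R u - u‖ ≤ ε := by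
  obtain ⟨v, ⟨φ, rfl⟩, hv⟩ := Metric.mem_closure_iff.1 (dense_range_testToL2 u) (ε / 2) (by linarith)
  rw [dist_eq_norm] at hv
  obtain ⟨r, hr⟩ := φ.hasCompactSupport.isCompact.isBounded.exists_norm_le
  filter_upwards [eventually_ge_atTop r, eventually_gt_atTop 0] with R hR hR0
  have h1 : cutoffCLM R (testToL2 φ) = testToL2 φ := by
    apply Lp.ext
    filter_upwards [coeFn_mulL2 (w := fun x => (cutoff R x : ℂ)) (testToL2 φ)
      (hw := (Complex.continuous_ofReal.comp (contDiff_cutoff R).continuous).measurable)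
      (hC := norm_cutoff_le R), coeFn_testToL2 φ] with x hx hφ
    rw [cutoffCLM, hx, hφ]
    by_cases h : x ∈ tsupport φ
    · rw [cutoff_eq_one hR0 ((hr x h).trans hR)]; simp
    · rw [image_eq_zero_of_notMem_tsupport h, mul_zero]
  have h2 : cutoffCLM R u - u = cutoffCLM R (u - testToL2 φ) - (u - testToL2 φ) := by
    rw [map_sub, h1]; abel
  rw [h2]
  have h3 : ‖cutoffCLM R (u - testToL2 φ)‖ ≤ 1 * ‖u - testToL2 φ‖ := norm_mulL2_le _
  calc _ ≤ ‖cutoffCLM R (u - testToL2 φ)‖ + ‖u - testToL2 φ‖ := norm_sub_le _ _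
    _ ≤ ε := by linarith

/-- The product of a smooth function and a test function. -/
def smulTest (χ : Plane → ℝ) (hχ : ContDiff ℝ ∞ χ) (φ : Test) : Test where
  toFun x := (χ x : ℂ) * φ x
  contDiff' := (Complex.ofRealCLM.contDiff.comp hχ).mul φ.contDiff
  hasCompactSupport' := φ.hasCompactSupport.mul_left
  tsupport_subset' := fun x _ => mem_univ x

theorem ladderFun_smulTest (A : C(Plane, Plane)) (σ : ℂ) {χ : Plane → ℝ} (hχ : ContDiff ℝ ∞ χ)
    (φ : Test) (x : Plane) :
    ladderFun A σ (smulTest χ hχ φ) x = χ x * ladderFun A σ φ x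
      - Complex.I * (fderiv ℝ χ x (e 0) + σ * fderiv ℝ χ x (e 1)) * φ x := by
  have h1 : HasFDerivAt (fun x => (χ x : ℂ)) (Complex.ofRealCLM.comp (fderiv ℝ χ x)) x :=
    Complex.ofRealCLM.hasFDerivAt.comp x (hχ.differentiable (by simp) x).hasFDerivAt
  have h2 : HasFDerivAt (smulTest χ hχ φ) _ x := h1.mul (differentiable_test φ x).hasFDerivAt
  have h3 : smulTest χ hχ φ x = χ x * φ x := rfl
  simp only [ladderFun, momentumFun, h2.fderiv, h3]
  simp
  ring

end Cutoff

/-! ### Weak ladder derivatives are strong. -/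

section WeakStrong

variable {A : C(Plane, Plane)} {σ : ℂ}

/-- `g` is the weak `π₁ + σ π₂`-derivative of `u`. -/
def IsWeakLadder (A : C(Plane, Plane)) (σ : ℂ) (u g : L2) : Prop :=
  ∀ φ : Test, ⟪ladderL2 (conj σ) (momentumTest A φ), u⟫_ℂ = ⟪testToL2 φ, g⟫_ℂ

theorem norm_testToL2_sub_le {φ : Test} {f : Plane → ℂ} (hf : MemLp f 2 volume) {ε : ℝ}
    (hε : 0 ≤ ε) (h : eLpNorm (⇑φ - f) 2 volume ≤ ENNReal.ofReal ε) :
    ‖testToL2 φ - hf.toLp f‖ ≤ ε := by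
  have : testToL2 φ - hf.toLp f = ((memLp_test φ).sub hf).toLp _ := rfl
  rw [this, Lp.norm_toLp]
  exact ENNReal.toReal_le_of_le_ofReal hε h

theorem norm_ladder_sub_le {φ : Test} {f : Plane → ℂ} (hf : MemLp f 2 volume) {ε : ℝ}
    (hε : 0 ≤ ε) (h : eLpNorm (ladderFun A σ φ - f) 2 volume ≤ ENNReal.ofReal ε) :
    ‖ladderL2 σ (momentumTest A φ) - hf.toLp f‖ ≤ ε := by
  rw [Lp.norm_def]
  refine ENNReal.toReal_le_of_le_ofReal hε (le_of_eq_of_le (eLpNorm_congr_ae ?_) h)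
  filter_upwards [Lp.coeFn_sub (ladderL2 σ (momentumTest A φ)) (hf.toLp f), coeFn_ladder σ φ,
    hf.coeFn_toLp] with x h1 h2 h3
  rw [h1, Pi.sub_apply, h2, h3, Pi.sub_apply]

/-- The weak and the strong `π₁ + σ π₂`-derivative agree. -/
theorem IsWeakLadder.exists_test_approx {u g : L2} (h : IsWeakLadder A σ u g) {ε : ℝ}
    (hε : 0 < ε) : ∃ φ : Test, ‖testToL2 φ - u‖ ≤ ε ∧
      ‖ladderL2 σ (momentumTest A φ) - g‖ ≤ ε := by
  obtain ⟨C, hC0, hC⟩ := exists_norm_fderiv_cutoff_le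
  have hlim : ∀ᶠ R : ℝ in atTop, C / R * (1 + ‖σ‖) * ‖u‖ ≤ ε / 4 := by
    have h1 : Tendsto (fun R : ℝ => C / R * (1 + ‖σ‖) * ‖u‖) atTop (𝓝 (0 * (1 + ‖σ‖) * ‖u‖)) :=
      ((tendsto_const_nhds.div_atTop tendsto_id).mul_const _).mul_const _
    rw [zero_mul, zero_mul] at h1
    exact h1.eventually (Iic_mem_nhds (by linarith))
  obtain ⟨R, hRu, hRg, hR, hR0⟩ := ((eventually_norm_cutoffCLM_sub_le u
    (by linarith : 0 < ε / 2)).and ((eventually_norm_cutoffCLM_sub_le g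
    (by linarith : 0 < ε / 4)).and (hlim.and (eventually_gt_atTop 0)))).exists
  set χ := cutoff R with hχdef
  have hχ : ContDiff ℝ ∞ χ := contDiff_cutoff R
  have hχm : Measurable fun x => (χ x : ℂ) :=
    (Complex.continuous_ofReal.comp hχ.continuous).measurable
  -- The commutator of `π₁ + σ π₂` with the cutoff. It is of order `1 / R`, so `χ u` has the weak
  -- derivative `χ g + w u`, which is close to `g` for large `R`.
  set w : Plane → ℂ := fun x =>
    -Complex.I * ((fderiv ℝ χ x (e 0) : ℂ) + σ * (fderiv ℝ χ x (e 1) : ℂ)) with hw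
  have hχ1 : ∀ j, Continuous fun x => (fderiv ℝ χ x (e j) : ℂ) := fun j =>
    Complex.continuous_ofReal.comp ((hχ.continuous_fderiv (by simp)).clm_apply continuous_const)
  have hwc : Continuous w :=
    continuous_const.mul ((hχ1 0).add (continuous_const.mul (hχ1 1)))
  have hwC : ∀ x, ‖w x‖ ≤ C / R * (1 + ‖σ‖) := by
    intro x
    have h1 : ∀ j, ‖(fderiv ℝ χ x (e j) : ℂ)‖ ≤ C / R := by
      intro j
      rw [Complex.norm_real]
      refine ((fderiv ℝ χ x).le_opNorm _).trans ?_
      simpa using hC R hR0 x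
    calc ‖w x‖ = ‖(fderiv ℝ χ x (e 0) : ℂ) + σ * (fderiv ℝ χ x (e 1) : ℂ)‖ := by
          rw [hw]; simp
      _ ≤ C / R + ‖σ‖ * (C / R) := by
          refine (norm_add_le _ _).trans (add_le_add (h1 0) ?_)
          rw [norm_mul]
          exact mul_le_mul_of_nonneg_left (h1 1) (norm_nonneg _)
      _ = _ := by ring
  have hf : MemLp (fun x => (χ x : ℂ) * u x) 2 volume :=
    memLp_bounded_mul hχm (norm_cutoff_le R) u
  have hg : MemLp (fun x => (χ x : ℂ) * g x + w x * u x) 2 volume :=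
    (memLp_bounded_mul hχm (norm_cutoff_le R) g).add (memLp_bounded_mul hwc.measurable hwC u)
  have hfm : StronglyMeasurable fun x => (χ x : ℂ) * u x :=
    hχm.stronglyMeasurable.mul (Lp.stronglyMeasurable u)
  have hgm : StronglyMeasurable fun x => (χ x : ℂ) * g x + w x * u x :=
    (hχm.stronglyMeasurable.mul (Lp.stronglyMeasurable g)).add
      (hwc.stronglyMeasurable.mul (Lp.stronglyMeasurable u))
  have hfc : HasCompactSupport fun x => (χ x : ℂ) * u x :=
    ((hasCompactSupport_cutoff hR0).comp_left Complex.ofReal_zero).mul_right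
  have hconj : ∀ φ : Test, MemLp (fun x => conj (φ x)) 2 (volume : Measure Plane) := fun φ =>
    (Complex.continuous_conj.comp φ.continuous).memLp_of_hasCompactSupport
      (hasCompactSupport_conj_test φ)
  have hweak : ∀ φ : Test, ∫ x, ((χ x : ℂ) * u x) * conj (ladderFun A (conj σ) φ x)
      = ∫ x, ((χ x : ℂ) * g x + w x * u x) * conj (φ x) := by
    intro φ
    have hφ := h (smulTest χ hχ φ)
    rw [inner_ladder, inner_testToL2] at hφ
    have hlc : MemLp (fun x => conj (ladderFun A (conj σ) (smulTest χ hχ φ) x)) 2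
        (volume : Measure Plane) := by
      refine (Complex.continuous_conj.comp
        (continuous_ladderFun (A := A) (conj σ) (smulTest χ hχ φ))).memLp_of_hasCompactSupport ?_
      exact ((hasCompactSupport_momentumFun _ 0).add
        ((hasCompactSupport_momentumFun _ 1).mul_left)).comp_left
          (g := fun z : ℂ => conj z) (map_zero _)
    have i1 : Integrable (fun x => u x * conj (ladderFun A (conj σ) (smulTest χ hχ φ) x)) volume :=
      (Lp.memLp u).integrable_mul hlc
    have i2 : Integrable (fun x => (w x * u x) * conj (φ x)) volume :=
      (memLp_bounded_mul hwc.measurable hwC u).integrable_mul (hconj φ)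
    have i3 : Integrable (fun x => g x * conj (smulTest χ hχ φ x)) volume :=
      (Lp.memLp g).integrable_mul (hconj _)
    have e1 : ∀ x, ((χ x : ℂ) * u x) * conj (ladderFun A (conj σ) φ x)
        = u x * conj (ladderFun A (conj σ) (smulTest χ hχ φ) x) + (w x * u x) * conj (φ x) := by
      intro x
      rw [ladderFun_smulTest]
      simp [hw]
      ring
    have e2 : ∀ x, ((χ x : ℂ) * g x + w x * u x) * conj (φ x)
        = g x * conj (smulTest χ hχ φ x) + (w x * u x) * conj (φ x) := by
      intro x
      have : smulTest χ hχ φ x = χ x * φ x := rfl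
      rw [this, map_mul, Complex.conj_ofReal]
      ring
    simp only [e1, e2]
    rw [integral_add i1 i2, integral_add i3 i2, hφ]
  obtain ⟨φ, h1, h2⟩ := exists_test_approx_of_compactSupport hf hfm hfc hg hgm hweak
    (by linarith : 0 < ε / 2)
  have h1' := norm_testToL2_sub_le hf (by linarith) h1
  have h2' := norm_ladder_sub_le hg (by linarith) h2
  have e1 : hf.toLp _ = cutoffCLM R u := rfl
  have e2 : hg.toLp _ = cutoffCLM R g + mulL2 w _ hwc.measurable hwC u := rfl
  have h3 : ‖mulL2 w _ hwc.measurable hwC u‖ ≤ ε / 4 := (norm_mulL2_le u).trans hR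
  rw [e1] at h1'
  rw [e2] at h2'
  refine ⟨φ, ?_, ?_⟩
  · calc _ ≤ ‖testToL2 φ - cutoffCLM R u‖ + ‖cutoffCLM R u - u‖ := norm_sub_le_norm_sub_add_norm_sub _ _ _
      _ ≤ ε := by linarith
  · set q := mulL2 w _ hwc.measurable hwC u
    calc _ = ‖(ladderL2 σ (momentumTest A φ) - (cutoffCLM R g + q)) + (cutoffCLM R g - g) + q‖ := by
          congr 1; abel
      _ ≤ ‖ladderL2 σ (momentumTest A φ) - (cutoffCLM R g + q)‖ + ‖cutoffCLM R g - g‖ + ‖q‖ :=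
          norm_add₃_le
      _ ≤ ε := by linarith

end WeakStrong

/-! ### The form domain, the magnetic ladder pair and the Hamiltonian. -/

section FormDomain

variable {A : C(Plane, Plane)} {σ : ℂ}

theorem norm_fderiv_le_gradSup {W : Plane → ℝ} (hW : HasBoundedGradient W) (x : Plane) :
    ‖fderiv ℝ W x‖ ≤ gradSup W := le_ciSup hW.2 x

theorem gradSup_nonneg (W : Plane → ℝ) : 0 ≤ gradSup W := Real.iSup_nonneg fun _ => norm_nonneg _

theorem norm_ladder_gradient_le {W : Plane → ℝ} (hW : HasBoundedGradient W) (σ : ℂ) (x : Plane) :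
    ‖-Complex.I * ((fderiv ℝ W x (e 0) : ℂ) + σ * (fderiv ℝ W x (e 1) : ℂ))‖
      ≤ (1 + ‖σ‖) * gradSup W := by
  have h1 : ∀ j, ‖(fderiv ℝ W x (e j) : ℂ)‖ ≤ gradSup W := by
    intro j
    rw [Complex.norm_real]
    refine ((fderiv ℝ W x).le_opNorm _).trans ?_
    simpa using norm_fderiv_le_gradSup hW x
  rw [norm_mul, norm_neg, Complex.norm_I, one_mul]
  refine (norm_add_le _ _).trans ?_
  rw [norm_mul, add_mul, one_mul]
  exact add_le_add (h1 0) (mul_le_mul_of_nonneg_left (h1 1) (norm_nonneg _))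

theorem measurable_ladder_gradient (W : Plane → ℝ) (σ : ℂ) :
    Measurable fun x =>
      -Complex.I * ((fderiv ℝ W x (e 0) : ℂ) + σ * (fderiv ℝ W x (e 1) : ℂ)) :=
  measurable_const.mul
    ((Complex.measurable_ofReal.comp (measurable_fderiv_apply_const ℝ W (e 0))).add
      (measurable_const.mul
        (Complex.measurable_ofReal.comp (measurable_fderiv_apply_const ℝ W (e 1)))))

/-- Multiplication by the commutator `[π₁ + σ π₂, W] = -i (∂₁ W + σ ∂₂ W)`. -/
def gradientCLM (W : Plane → ℝ) (hW : HasBoundedGradient W) (σ : ℂ) : L2 →L[ℂ] L2 :=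
  mulL2 (fun x => -Complex.I * ((fderiv ℝ W x (e 0) : ℂ) + σ * (fderiv ℝ W x (e 1) : ℂ)))
    ((1 + ‖σ‖) * gradSup W) (measurable_ladder_gradient W σ) (norm_ladder_gradient_le hW σ)

/-- The Leibniz rule for `π₁ + σ π₂` on test functions, in the weak sense. -/
theorem isWeakLadder_potential (W : Plane →ᵇ ℝ) (hW : HasBoundedGradient W) (ψ : Test) :
    IsWeakLadder A σ (potentialCLM W (testToL2 ψ))
      (potentialCLM W (ladderL2 σ (momentumTest A ψ)) + gradientCLM W hW σ (testToL2 ψ)) := by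
  intro φ
  obtain ⟨i0, j0, e0⟩ := integral_mul_conj_momentumFun (A := A) φ ψ hW 0
  obtain ⟨i1, j1, e1⟩ := integral_mul_conj_momentumFun (A := A) φ ψ hW 1
  rw [inner_ladder, inner_testToL2]
  have h1 : ∫ x, potentialCLM W (testToL2 ψ) x * conj (ladderFun A (conj σ) φ x)
      = ∫ x, (W x * ψ x * starRingEnd ℂ (momentumFun A φ x 0)
        + σ * (W x * ψ x * starRingEnd ℂ (momentumFun A φ x 1))) := by
    apply integral_congr_ae
    filter_upwards [coeFn_potentialCLM W (testToL2 ψ), coeFn_testToL2 ψ] with x hx hψ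
    rw [hx, hψ, ladderFun]
    simp only [map_add, map_mul, Complex.conj_conj]
    ring
  have h2 : ∫ x, (potentialCLM W (ladderL2 σ (momentumTest A ψ))
        + gradientCLM W hW σ (testToL2 ψ) : L2) x * conj (φ x)
      = ∫ x, ((W x * momentumFun A ψ x 0 - Complex.I * fderiv ℝ W x (e 0) * ψ x) * conj (φ x)
        + σ * ((W x * momentumFun A ψ x 1 - Complex.I * fderiv ℝ W x (e 1) * ψ x)
          * conj (φ x))) := by
    apply integral_congr_ae
    filter_upwards [coeFn_potentialCLM W (ladderL2 σ (momentumTest A ψ)), coeFn_testToL2 ψ,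
      coeFn_ladder (A := A) σ ψ, Lp.coeFn_add (potentialCLM W (ladderL2 σ (momentumTest A ψ)))
        (gradientCLM W hW σ (testToL2 ψ)), coeFn_mulL2 (hw := measurable_ladder_gradient W σ)
        (hC := norm_ladder_gradient_le hW σ) (testToL2 ψ)] with x h1 h2 h3 h4 h5
    rw [h4, Pi.add_apply, h1, h3, gradientCLM, h5, h2, ladderFun]
    ring
  rw [h1, h2, integral_add i0 (i1.const_mul σ), integral_add j0 (j1.const_mul σ),
    integral_const_mul, integral_const_mul, e0, e1]

theorem potentialCLM_one (u : L2) : potentialCLM (BoundedContinuousFunction.const Plane 1) u = u := by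
  apply Lp.ext
  filter_upwards [coeFn_potentialCLM (BoundedContinuousFunction.const Plane 1) u] with x hx
  rw [hx]
  simp

/-- `π₁ + σ π₂` and `π₁ + σ̄ π₂` are formally adjoint. -/
theorem isWeakLadder_test (ψ : Test) :
    IsWeakLadder A σ (testToL2 ψ) (ladderL2 σ (momentumTest A ψ)) := by
  -- The Leibniz rule with `W = 1`, whose gradient term vanishes.
  set W : Plane →ᵇ ℝ := BoundedContinuousFunction.const Plane 1 with hWdef
  have hW0 : ∀ x, fderiv ℝ W x = 0 := fun x => fderiv_const_apply (1 : ℝ)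
  have hW : HasBoundedGradient W :=
    ⟨differentiable_const _, 0, by rintro _ ⟨x, rfl⟩; simp [hW0]⟩
  have h := isWeakLadder_potential (A := A) (σ := σ) W hW ψ
  have h2 : gradientCLM W hW σ (testToL2 ψ) = 0 := by
    apply Lp.ext
    filter_upwards [coeFn_mulL2 (hw := measurable_ladder_gradient W σ)
        (hC := norm_ladder_gradient_le hW σ) (testToL2 ψ), Lp.coeFn_zero ℂ 2 volume] with x hx h0
    rw [gradientCLM, hx, h0]
    simp [hW0]
  rwa [h2, add_zero, hWdef, potentialCLM_one, potentialCLM_one] at h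

/-- `‖(π₁ + σ π₂) φ‖² = ‖(p - A) φ‖² + i σ ⟨φ, B φ⟩` for `σ = ± i`, in polarised form. -/
theorem inner_ladder_ladder {B : Plane →ᵇ ℝ} (hA : IsVectorPotential A B) (hσ : conj σ = -σ)
    (hσ2 : σ * σ = -1) (φ ψ : Test) :
    ⟪ladderL2 σ (momentumTest A φ), ladderL2 σ (momentumTest A ψ)⟫_ℂ =
      ⟪momentumTest A φ, momentumTest A ψ⟫_ℂ
        + σ * Complex.I * ⟪testToL2 φ, potentialCLM B (testToL2 ψ)⟫_ℂ := by
  have i1 : ∀ j k, Integrable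
      (fun x => momentumFun A ψ x j * starRingEnd ℂ (momentumFun A φ x k)) volume :=
    fun j k => ((continuous_momentumFun ψ j).mul (Complex.continuous_conj.comp
      (continuous_momentumFun φ k))).integrable_of_hasCompactSupport
      (hasCompactSupport_momentumFun ψ j).mul_right
  have h1 : ⟪ladderL2 σ (momentumTest A φ), ladderL2 σ (momentumTest A ψ)⟫_ℂ =
      ∫ x, ((momentumFun A ψ x 0 * starRingEnd ℂ (momentumFun A φ x 0)
        + momentumFun A ψ x 1 * starRingEnd ℂ (momentumFun A φ x 1))
        + σ * (momentumFun A ψ x 1 * starRingEnd ℂ (momentumFun A φ x 0)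
        - momentumFun A ψ x 0 * starRingEnd ℂ (momentumFun A φ x 1))) := by
    rw [inner_ladder]
    apply integral_congr_ae
    filter_upwards [coeFn_ladder (A := A) σ ψ] with x hx
    rw [hx, ladderFun, ladderFun, map_add, map_mul, hσ]
    linear_combination (-(momentumFun A ψ x 1 * starRingEnd ℂ (momentumFun A φ x 1))) * hσ2
  have h2 : ⟪momentumTest A φ, momentumTest A ψ⟫_ℂ =
      ∫ x, (momentumFun A ψ x 0 * starRingEnd ℂ (momentumFun A φ x 0)
        + momentumFun A ψ x 1 * starRingEnd ℂ (momentumFun A φ x 1)) := by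
    rw [L2.inner_def]
    apply integral_congr_ae
    filter_upwards [coeFn_momentumTest (A := A) ψ, coeFn_momentumTest (A := A) φ] with x hx hy
    rw [hx, hy, PiLp.inner_apply, Fin.sum_univ_two]
    rfl
  have h3 : ⟪testToL2 φ, potentialCLM B (testToL2 ψ)⟫_ℂ = ∫ x, (B x * ψ x * conj (φ x)) := by
    rw [inner_testToL2]
    apply integral_congr_ae
    filter_upwards [coeFn_potentialCLM B (testToL2 ψ), coeFn_testToL2 ψ] with x hx hψ
    rw [hx, hψ]
  have i2 : Integrable (fun x => momentumFun A ψ x 0 * starRingEnd ℂ (momentumFun A φ x 0)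
        + momentumFun A ψ x 1 * starRingEnd ℂ (momentumFun A φ x 1)) volume :=
    (i1 0 0).add (i1 1 1)
  have i3 : Integrable (fun x => σ * (momentumFun A ψ x 1 * starRingEnd ℂ (momentumFun A φ x 0)
        - momentumFun A ψ x 0 * starRingEnd ℂ (momentumFun A φ x 1))) volume :=
    ((i1 1 0).sub (i1 0 1)).const_mul σ
  rw [h1, h2, h3, integral_add i2 i3, integral_const_mul,
    integral_commutator hA B.continuous φ ψ, integral_const_mul]
  ring

theorem mem_graph_momentum_iff {p : L2 × L2Vec} :
    p ∈ (momentum A).graph ↔ ∃ φ : Test, (testToL2 φ, momentumTest A φ) = p := by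
  have hval : ∀ (φ : Test) (h : testToL2 φ ∈ (momentum A).domain),
      momentum A ⟨testToL2 φ, h⟩ = momentumTest A φ := by
    intro φ h
    have : (LinearEquiv.ofInjective testToL2 testToL2_injective).symm ⟨testToL2 φ, h⟩ = φ := by
      rw [LinearEquiv.symm_apply_eq]
      rfl
    exact congrArg (momentumTest A) this
  rw [LinearPMap.mem_graph_iff]
  constructor
  · rintro ⟨⟨_, φ, rfl⟩, h1, h2⟩
    exact ⟨φ, Prod.ext h1 ((hval φ ⟨φ, rfl⟩).symm.trans h2)⟩
  · rintro ⟨φ, rfl⟩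
    exact ⟨⟨testToL2 φ, φ, rfl⟩, rfl, hval φ _⟩

theorem momentum_apply_test (φ : Test) (h : testToL2 φ ∈ (momentum A).domain) :
    momentum A ⟨testToL2 φ, h⟩ = momentumTest A φ :=
  ((LinearPMap.image_iff h).2 (mem_graph_momentum_iff.2 ⟨φ, rfl⟩)).symm

theorem exists_seq_of_mem_closure_graph {u : L2} {w : L2Vec}
    (h : (u, w) ∈ (momentum A).graph.topologicalClosure) :
    ∃ φ : ℕ → Test, Tendsto (fun k => testToL2 (φ k)) atTop (𝓝 u) ∧
      Tendsto (fun k => momentumTest A (φ k)) atTop (𝓝 w) := by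
  obtain ⟨p, hp, hlim⟩ := mem_closure_iff_seq_limit.1 h
  choose φ hφ using fun k => mem_graph_momentum_iff.1 (hp k)
  rw [Prod.tendsto_iff] at hlim
  refine ⟨φ, hlim.1.congr fun k => ?_, hlim.2.congr fun k => ?_⟩
  · rw [← hφ k]
  · rw [← hφ k]

theorem isWeakLadder_of_mem_closure_graph {u : L2} {w : L2Vec}
    (h : (u, w) ∈ (momentum A).graph.topologicalClosure) : IsWeakLadder A σ u (ladderL2 σ w) := by
  obtain ⟨φ, h1, h2⟩ := exists_seq_of_mem_closure_graph h
  intro χ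
  refine tendsto_nhds_unique (tendsto_const_nhds.inner h1)
    ((tendsto_const_nhds.inner (((ladderL2 σ).continuous.tendsto w).comp h2)).congr fun k => ?_)
  exact (isWeakLadder_test (φ k) χ).symm

theorem IsWeakLadder.unique {u g g' : L2} (h : IsWeakLadder A σ u g) (h' : IsWeakLadder A σ u g') :
    g = g' :=
  ext_of_forall_inner_test fun φ => (h φ).symm.trans (h' φ)

/-- A limit `w` of `(p - A) φ_k` with `φ_k → 0` has vanishing `w₀ + σ w₁` for every `σ`, by
uniqueness of weak derivatives; `σ = 0` and `σ = 1` recover both components. -/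
theorem isClosable_momentum : (momentum A).IsClosable := by
  refine ⟨(momentum A).graph.topologicalClosure.toLinearPMap, ?_⟩
  rw [Submodule.toLinearPMap_graph_eq]
  rintro ⟨u, w⟩ h hu
  simp only at hu ⊢
  subst hu
  have h0 : ∀ σ : ℂ, ladderL2 σ w = 0 := fun σ =>
    (isWeakLadder_of_mem_closure_graph h).unique fun φ => by rw [inner_zero_right, inner_zero_right]
  apply Lp.ext
  filter_upwards [(ladderCLM 0).coeFn_compLpL w, (ladderCLM 1).coeFn_compLpL w,
    Lp.coeFn_zero (EuclideanSpace ℂ (Fin 2)) 2 volume, Lp.coeFn_zero ℂ 2 volume]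
    with x h1 h2 h3 h4
  have e1 := h0 0
  have e2 := h0 1
  rw [ladderL2] at e1 e2
  rw [e1, h4] at h1
  rw [e2, h4] at h2
  rw [h3]
  simp only [ladderCLM_apply, Pi.zero_apply, zero_mul, add_zero, one_mul] at h1 h2
  ext j
  fin_cases j
  · exact h1.symm
  · simpa [← h1] using h2.symm

theorem mem_closure_graph_iff {u : L2} {w : L2Vec} :
    (u, w) ∈ (momentum A).graph.topologicalClosure ↔
      ∃ h : u ∈ (momentum A).closure.domain, (momentum A).closure ⟨u, h⟩ = w := by
  rw [isClosable_momentum.graph_closure_eq_closure_graph, LinearPMap.mem_graph_iff]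
  constructor
  · rintro ⟨⟨y, hy⟩, rfl, h⟩
    exact ⟨hy, h⟩
  · rintro ⟨h, e⟩
    exact ⟨⟨u, h⟩, rfl, e⟩

theorem exists_seq_closure (u : (momentum A).closure.domain) :
    ∃ φ : ℕ → Test, Tendsto (fun k => testToL2 (φ k)) atTop (𝓝 (u : L2)) ∧
      Tendsto (fun k => momentumTest A (φ k)) atTop (𝓝 ((momentum A).closure u)) :=
  exists_seq_of_mem_closure_graph (mem_closure_graph_iff.2 ⟨u.2, rfl⟩)

theorem test_mem_closure (φ : Test) : ∃ h : testToL2 φ ∈ (momentum A).closure.domain,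
    (momentum A).closure ⟨testToL2 φ, h⟩ = momentumTest A φ :=
  mem_closure_graph_iff.1
    (Submodule.le_topologicalClosure _ (mem_graph_momentum_iff.2 ⟨φ, rfl⟩))

/-- For `σ = ± i` the forms `‖π φ‖²` and `‖(π₁ + σ π₂) φ‖²` differ by `± ⟪φ, B φ⟫`. Hence a single
ladder derivative controls the full momentum, and `a`, `c` and the closure of `p - A` share one
domain. -/
theorem norm_momentumTest_le {B : Plane →ᵇ ℝ} (hA : IsVectorPotential A B) (hσ : conj σ = -σ)
    (hσ2 : σ * σ = -1) (φ : Test) :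
    ‖momentumTest A φ‖ ≤ ‖ladderL2 σ (momentumTest A φ)‖ + √‖B‖ * ‖testToL2 φ‖ := by
  have hnorm : ‖σ‖ = 1 := by
    have : ‖σ‖ * ‖σ‖ = 1 := by rw [← norm_mul, hσ2]; simp
    nlinarith [norm_nonneg σ]
  have h := inner_ladder_ladder hA hσ hσ2 φ φ
  have h1 : ‖⟪momentumTest A φ, momentumTest A φ⟫_ℂ‖ ≤
      ‖⟪ladderL2 σ (momentumTest A φ), ladderL2 σ (momentumTest A φ)⟫_ℂ‖
        + ‖⟪testToL2 φ, potentialCLM B (testToL2 φ)⟫_ℂ‖ := by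
    rw [eq_sub_of_add_eq h.symm]
    refine (norm_sub_le _ _).trans (le_of_eq ?_)
    rw [norm_mul, norm_mul, hnorm, Complex.norm_I, one_mul, one_mul]
  have h2 : ‖⟪testToL2 φ, potentialCLM B (testToL2 φ)⟫_ℂ‖ ≤ ‖testToL2 φ‖ * (‖B‖ * ‖testToL2 φ‖) :=
    (norm_inner_le_norm _ _).trans (mul_le_mul_of_nonneg_left (norm_mulL2_le _) (norm_nonneg _))
  simp only [inner_self_eq_norm_sq_to_K, norm_pow, RCLike.norm_ofReal, abs_norm] at h1
  refine le_of_sq_le_sq ?_ (by positivity)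
  have h3 : √‖B‖ ^ 2 = ‖B‖ := Real.sq_sqrt (norm_nonneg _)
  have h4 : 0 ≤ ‖ladderL2 σ (momentumTest A φ)‖ * (√‖B‖ * ‖testToL2 φ‖) := by positivity
  have h5 : (√‖B‖ * ‖testToL2 φ‖) ^ 2 = ‖testToL2 φ‖ * (‖B‖ * ‖testToL2 φ‖) := by
    rw [mul_pow, h3]; ring
  nlinarith

/-- An element of `L²` with a weak `π₁ ± i π₂`-derivative in `L²` lies in the form domain. -/
theorem IsWeakLadder.mem_closure_domain {B : Plane →ᵇ ℝ} (hA : IsVectorPotential A B)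
    (hσ : conj σ = -σ) (hσ2 : σ * σ = -1) {u g : L2} (h : IsWeakLadder A σ u g) :
    ∃ hu : u ∈ (momentum A).closure.domain, ladderL2 σ ((momentum A).closure ⟨u, hu⟩) = g := by
  have hpos : ∀ k : ℕ, (0 : ℝ) < 1 / ((k : ℝ) + 1) := fun k => Nat.one_div_pos_of_nat
  choose φ h1 h2 using fun k : ℕ => h.exists_test_approx (hpos k)
  have t1 : Tendsto (fun k => testToL2 (φ k)) atTop (𝓝 u) := by
    rw [tendsto_iff_norm_sub_tendsto_zero]
    exact squeeze_zero (fun _ => norm_nonneg _) h1 tendsto_one_div_add_atTop_nhds_zero_nat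
  have t2 : Tendsto (fun k => ladderL2 σ (momentumTest A (φ k))) atTop (𝓝 g) := by
    rw [tendsto_iff_norm_sub_tendsto_zero]
    exact squeeze_zero (fun _ => norm_nonneg _) h2 tendsto_one_div_add_atTop_nhds_zero_nat
  have hc : CauchySeq fun k => momentumTest A (φ k) := by
    have c1 := cauchySeq_iff_tendsto_dist_atTop_0.1 t1.cauchySeq
    have c2 := cauchySeq_iff_tendsto_dist_atTop_0.1 t2.cauchySeq
    rw [cauchySeq_iff_tendsto_dist_atTop_0]
    have c3 := c2.add (c1.const_mul √‖B‖)
    rw [mul_zero, add_zero] at c3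
    refine squeeze_zero (fun _ => dist_nonneg) (fun n => ?_) c3
    rw [dist_eq_norm, dist_eq_norm, dist_eq_norm, ← map_sub, ← map_sub, ← map_sub]
    exact norm_momentumTest_le hA hσ hσ2 _
  obtain ⟨w, hw⟩ := cauchySeq_tendsto_of_complete hc
  have hmem : (u, w) ∈ (momentum A).graph.topologicalClosure :=
    mem_closure_iff_seq_limit.2 ⟨fun k => (testToL2 (φ k), momentumTest A (φ k)),
      fun k => mem_graph_momentum_iff.2 ⟨φ k, rfl⟩, t1.prodMk_nhds hw⟩
  obtain ⟨hu, e⟩ := mem_closure_graph_iff.1 hmem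
  refine ⟨hu, ?_⟩
  rw [e]
  exact tendsto_nhds_unique (((ladderL2 σ).continuous.tendsto w).comp hw) t2

theorem inner_ladder_closure {B : Plane →ᵇ ℝ} (hA : IsVectorPotential A B) (hσ : conj σ = -σ)
    (hσ2 : σ * σ = -1) (u v : (momentum A).closure.domain) :
    ⟪ladderL2 σ ((momentum A).closure u), ladderL2 σ ((momentum A).closure v)⟫_ℂ =
      ⟪(momentum A).closure u, (momentum A).closure v⟫_ℂ
        + σ * Complex.I * ⟪(u : L2), potentialCLM B v⟫_ℂ := by
  obtain ⟨φ, f1, f2⟩ := exists_seq_closure u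
  obtain ⟨ψ, g1, g2⟩ := exists_seq_closure v
  refine tendsto_nhds_unique ((((ladderL2 σ).continuous.tendsto _).comp f2).inner
    (((ladderL2 σ).continuous.tendsto _).comp g2)) (((f2.inner g2).add ((f1.inner
      (((potentialCLM B).continuous.tendsto _).comp g1)).const_mul (σ * Complex.I))).congr
      fun k => ?_)
  exact (inner_ladder_ladder hA hσ hσ2 (φ k) (ψ k)).symm

theorem inner_ladder_adjoint (u v : (momentum A).closure.domain) :
    ⟪ladderL2 (conj σ) ((momentum A).closure u), (v : L2)⟫_ℂ
      = ⟪(u : L2), ladderL2 σ ((momentum A).closure v)⟫_ℂ := by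
  obtain ⟨φ, f1, f2⟩ := exists_seq_closure u
  refine tendsto_nhds_unique ((((ladderL2 (conj σ)).continuous.tendsto _).comp f2).inner
    tendsto_const_nhds) ((f1.inner tendsto_const_nhds).congr fun k => ?_)
  exact ((isWeakLadder_of_mem_closure_graph (mem_closure_graph_iff.2 ⟨v.2, rfl⟩)) (φ k)).symm

theorem conj_neg_I_eq : conj (-Complex.I) = Complex.I := by simp

/-- The ladder operators `π₁ ± i π₂` of the magnetic field `B`. -/
def magneticLadder (A : C(Plane, Plane)) (B : Plane →ᵇ ℝ) (hA : IsVectorPotential A B) :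
    LadderPair L2 where
  dom := (momentum A).closure.domain
  a := (ladderL2 Complex.I).toLinearMap ∘ₗ (momentum A).closure.toFun
  c := (ladderL2 (-Complex.I)).toLinearMap ∘ₗ (momentum A).closure.toFun
  -- In the sense of forms `c a = π² - B` and `a c = π² + B`.
  β := (2 : ℂ) • potentialCLM B
  inner_a u v := by
    have := inner_ladder_adjoint (A := A) (σ := -Complex.I) u v
    rwa [conj_neg_I_eq] at this
  -- Testing only against test functions shows that `g` is a weak derivative of `u`; weak
  -- derivatives lie in the form domain.
  a_max u g h := by
    refine IsWeakLadder.mem_closure_domain hA (σ := Complex.I) (by simp) (by simp) fun φ => ?_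
    obtain ⟨hφ, e⟩ := test_mem_closure (A := A) φ
    rw [Complex.conj_I, ← e]
    exact h ⟨_, hφ⟩
  c_max u g h := by
    refine IsWeakLadder.mem_closure_domain hA (σ := -Complex.I) (by simp) (by simp) fun φ => ?_
    obtain ⟨hφ, e⟩ := test_mem_closure (A := A) φ
    rw [conj_neg_I_eq, ← e]
    exact h ⟨_, hφ⟩
  comm u v := by
    have h1 := inner_ladder_closure hA (σ := Complex.I) (by simp) (by simp) u v
    have h2 := inner_ladder_closure hA (σ := -Complex.I) (by simp) (by simp) u v
    rw [Complex.I_mul_I] at h1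
    rw [neg_mul, Complex.I_mul_I] at h2
    change ⟪ladderL2 (-Complex.I) ((momentum A).closure u),
      ladderL2 (-Complex.I) ((momentum A).closure v)⟫_ℂ =
      ⟪ladderL2 Complex.I ((momentum A).closure u), ladderL2 Complex.I ((momentum A).closure v)⟫_ℂ
        + ⟪(u : L2), (2 : ℂ) • potentialCLM B v⟫_ℂ
    rw [h1, h2, inner_smul_right]
    ring

theorem isWeakLadder_potential_closure (W : Plane →ᵇ ℝ) (hW : HasBoundedGradient W)
    (u : (momentum A).closure.domain) :
    IsWeakLadder A σ (potentialCLM W u)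
      (potentialCLM W (ladderL2 σ ((momentum A).closure u)) + gradientCLM W hW σ u) := by
  obtain ⟨φ, f1, f2⟩ := exists_seq_closure u
  intro χ
  refine tendsto_nhds_unique
    (tendsto_const_nhds.inner (((potentialCLM W).continuous.tendsto _).comp f1))
    ((tendsto_const_nhds.inner ((((potentialCLM W).continuous.tendsto _).comp
      (((ladderL2 σ).continuous.tendsto _).comp f2)).add
      (((gradientCLM W hW σ).continuous.tendsto _).comp f1))).congr fun k => ?_)
  exact (isWeakLadder_potential W hW (φ k) χ).symm

/-- The commutators are multiplication by `-i (∂₁W ± i ∂₂W)`; the factor `2` is the crude bound `1 +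
|σ|`. -/
theorem commBound_potential {B : Plane →ᵇ ℝ} (hA : IsVectorPotential A B) (W : Plane →ᵇ ℝ)
    (hW : HasBoundedGradient W) {G : ℝ} (hG : 2 * gradSup W ≤ G) :
    (magneticLadder A B hA).CommBound (potentialCLM W) G := by
  intro u
  obtain ⟨h, e1⟩ := (isWeakLadder_potential_closure (σ := Complex.I) W hW u).mem_closure_domain
    hA (by simp) (by simp)
  obtain ⟨_, e2⟩ := (isWeakLadder_potential_closure (σ := -Complex.I) W hW u).mem_closure_domain
    hA (by simp) (by simp)
  have hb : ∀ σ : ℂ, ‖σ‖ = 1 → ‖gradientCLM W hW σ u‖ ≤ G * ‖(u : L2)‖ := by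
    intro σ hσ
    refine (norm_mulL2_le _).trans ?_
    rw [hσ]
    exact mul_le_mul_of_nonneg_right (by linarith) (norm_nonneg _)
  refine ⟨h, ?_, ?_⟩
  · change ‖ladderL2 Complex.I ((momentum A).closure ⟨_, h⟩)
      - potentialCLM W (ladderL2 Complex.I ((momentum A).closure u))‖ ≤ _
    rw [e1, add_sub_cancel_left]
    exact hb _ (by simp)
  · change ‖ladderL2 (-Complex.I) ((momentum A).closure ⟨_, h⟩)
      - potentialCLM W (ladderL2 (-Complex.I) ((momentum A).closure u))‖ ≤ _
    rw [e2, add_sub_cancel_left]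
    exact hb _ (by simp)

/-- The Hamiltonian is `c a + B + V`, with the same domain. -/
theorem hamiltonian_iff {B : Plane →ᵇ ℝ} (hA : IsVectorPotential A B) (V : Plane →ᵇ ℝ)
    {ψ f : L2} : (∃ h : ψ ∈ (hamiltonian A V).domain, hamiltonian A V ⟨ψ, h⟩ = f) ↔
      (magneticLadder A B hA).IsKin ψ (f - potentialCLM B ψ - potentialCLM V ψ) := by
  have hdense : Dense ((momentum A).domain : Set L2) := dense_range_testToL2
  have hinner : ∀ (h0 : ψ ∈ (momentum A).closure.domain) (φ : Test),
      ⟪ladderL2 Complex.I (momentumTest A φ), ladderL2 Complex.I ((momentum A).closure ⟨ψ, h0⟩)⟫_ℂ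
        = ⟪momentumTest A φ, (momentum A).closure ⟨ψ, h0⟩⟫_ℂ
          - ⟪testToL2 φ, potentialCLM B ψ⟫_ℂ := by
    intro h0 φ
    obtain ⟨hφ, e⟩ := test_mem_closure (A := A) φ
    have := inner_ladder_closure hA (σ := Complex.I) (by simp) (by simp) ⟨_, hφ⟩ ⟨ψ, h0⟩
    rw [Complex.I_mul_I, e] at this
    rw [this]
    ring
  constructor
  · rintro ⟨h, rfl⟩
    have h' : ψ ∈ (adjointCompClosure (momentum A)).domain := h
    obtain ⟨⟨y, hy, hyψ⟩, h0⟩ := h'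
    have hy0 : y = ⟨ψ, h0⟩ := Subtype.ext hyψ
    subst hy0
    have hy' : (momentum A).closure ⟨ψ, h0⟩ ∈ ((momentum A)†).domain := hy
    have e : hamiltonian A V ⟨ψ, h⟩
        = potentialCLM V ψ + (momentum A)† ⟨(momentum A).closure ⟨ψ, h0⟩, hy'⟩ := rfl
    rw [e]
    set k := (momentum A)† ⟨(momentum A).closure ⟨ψ, h0⟩, hy'⟩ with hk
    have hkφ : ∀ φ : Test, ⟪k, testToL2 φ⟫_ℂ
        = ⟪(momentum A).closure ⟨ψ, h0⟩, momentumTest A φ⟫_ℂ := by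
      intro φ
      have hφ : testToL2 φ ∈ (momentum A).domain := ⟨φ, rfl⟩
      have := LinearPMap.adjoint_isFormalAdjoint hdense
        ⟨(momentum A).closure ⟨ψ, h0⟩, hy'⟩ ⟨testToL2 φ, hφ⟩
      rwa [momentum_apply_test φ hφ] at this
    have e2 : potentialCLM V ψ + k - potentialCLM B ψ - potentialCLM V ψ = k - potentialCLM B ψ := by
      abel
    rw [e2]
    -- This is `D* D̄ ψ = k` rewritten through `π² = c a + B`. It gives the regularity of `a ψ`
    -- required for `c a ψ`.
    have hw : IsWeakLadder A (-Complex.I) (ladderL2 Complex.I ((momentum A).closure ⟨ψ, h0⟩))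
        (k - potentialCLM B ψ) := by
      intro φ
      rw [conj_neg_I_eq, hinner h0 φ, inner_sub_right, ← inner_conj_symm (testToL2 φ) k, hkφ φ,
        inner_conj_symm]
    obtain ⟨h1, e1⟩ := hw.mem_closure_domain hA (by simp) (by simp)
    exact ⟨h0, h1, e1⟩
  · intro hK
    obtain ⟨h0, hv⟩ := LadderPair.isKin_iff.1 hK
    have hφ : ∀ x : (momentum A).domain, ⟪f - potentialCLM V ψ, (x : L2)⟫_ℂ
        = ⟪(momentum A).closure ⟨ψ, h0⟩, momentum A x⟫_ℂ := by
      rintro ⟨x, hx⟩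
      obtain ⟨φ, rfl⟩ := id hx
      rw [momentum_apply_test φ hx]
      obtain ⟨hφ, e⟩ := test_mem_closure (A := A) φ
      have h1 := hv ⟨_, hφ⟩
      change ⟪ladderL2 Complex.I ((momentum A).closure ⟨_, hφ⟩),
        ladderL2 Complex.I ((momentum A).closure ⟨ψ, h0⟩)⟫_ℂ = ⟪testToL2 φ, _⟫_ℂ at h1
      rw [e, hinner h0 φ] at h1
      have h2 : ⟪momentumTest A φ, (momentum A).closure ⟨ψ, h0⟩⟫_ℂ
          = ⟪testToL2 φ, f - potentialCLM V ψ⟫_ℂ := by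
        rw [sub_right_comm, inner_sub_right _ (f - potentialCLM V ψ)] at h1
        linear_combination h1
      rw [← inner_conj_symm, ← h2, inner_conj_symm]
    have hmem : (momentum A).closure ⟨ψ, h0⟩ ∈ ((momentum A)†).domain :=
      LinearPMap.mem_adjoint_domain_of_exists _ ⟨_, hφ⟩
    have hval : (momentum A)† ⟨_, hmem⟩ = f - potentialCLM V ψ :=
      LinearPMap.adjoint_apply_eq hdense ⟨_, hmem⟩ hφ
    have hH : ψ ∈ (hamiltonian A V).domain := ⟨⟨⟨ψ, h0⟩, hmem, rfl⟩, h0⟩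
    refine ⟨hH, ?_⟩
    have e : hamiltonian A V ⟨ψ, hH⟩
        = potentialCLM V ψ + (momentum A)† ⟨(momentum A).closure ⟨ψ, h0⟩, hmem⟩ := rfl
    rw [e, hval]
    abel

end FormDomain

/-! ### Energies in a gap between local Landau levels. -/

section Gap

/-- The field `B` as a bounded continuous function. -/
def fieldBCF (B : Plane → ℝ) (hB : Continuous B) (C : ℝ) (hC : ∀ x, ‖B x‖ ≤ C) : Plane →ᵇ ℝ :=
  BoundedContinuousFunction.ofNormedAddCommGroup B hB C hC

/-- The function `(2 k + 1) B + V - E`. -/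
def levelFun (B V : Plane →ᵇ ℝ) (E : ℝ) (k : ℕ) : Plane →ᵇ ℝ :=
  B + (1 : ℝ) • V + (-E) • BoundedContinuousFunction.const Plane 1 + (2 * k : ℝ) • B

theorem levelFun_apply (B V : Plane →ᵇ ℝ) (E : ℝ) (k : ℕ) (x : Plane) :
    levelFun B V E k x = (2 * k + 1) * B x + V x - E := by
  simp [levelFun]
  ring

theorem potentialCLM_levelFun_zero (B V : Plane →ᵇ ℝ) (E : ℝ) (u : L2) :
    potentialCLM (levelFun B V E 0) u = potentialCLM B u + potentialCLM V u - (E : ℂ) • u := by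
  rw [levelFun, potentialCLM_add_smul, potentialCLM_add_smul, potentialCLM_add_smul]
  simp only [add_apply, neg_apply, smul_apply, potentialCLM_one, Complex.ofReal_one, one_smul,
    Complex.ofReal_neg, neg_smul, Nat.cast_zero, mul_zero, Complex.ofReal_zero, zero_smul, add_zero,
    sub_eq_add_neg]

theorem potentialCLM_levelFun (B V : Plane →ᵇ ℝ) (E : ℝ) (k : ℕ) :
    potentialCLM (levelFun B V E 0) + (k : ℂ) • (2 : ℂ) • potentialCLM B
      = potentialCLM (levelFun B V E k) := by
  rw [levelFun, levelFun, potentialCLM_add_smul, potentialCLM_add_smul _ B (2 * k), smul_smul]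
  simp [mul_comm]

theorem gradSup_levelFun {B V : Plane →ᵇ ℝ} (hB : HasBoundedGradient B)
    (hV : HasBoundedGradient V) (E : ℝ) (k : ℕ) : HasBoundedGradient (levelFun B V E k) ∧
      gradSup (levelFun B V E k) ≤ (2 * k + 1) * gradSup B + gradSup V := by
  have hfun : (levelFun B V E k : Plane → ℝ) = fun x => (2 * k + 1) * B x + V x - E :=
    funext (levelFun_apply B V E k)
  have hd : ∀ x, HasFDerivAt (levelFun B V E k)
      ((2 * k + 1 : ℝ) • fderiv ℝ B x + fderiv ℝ V x) x := by
    intro x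
    rw [hfun]
    exact (((hB.1 x).hasFDerivAt.const_mul (2 * k + 1 : ℝ)).add
      (hV.1 x).hasFDerivAt).sub_const E
  have hn : ∀ x, ‖fderiv ℝ (levelFun B V E k) x‖ ≤ (2 * k + 1) * gradSup B + gradSup V := by
    intro x
    rw [(hd x).fderiv]
    refine (norm_add_le _ _).trans (add_le_add ?_ (norm_fderiv_le_gradSup hV x))
    rw [norm_smul, Real.norm_of_nonneg (by positivity)]
    exact mul_le_mul_of_nonneg_left (norm_fderiv_le_gradSup hB x) (by positivity)
  exact ⟨⟨fun x => (hd x).differentiableAt, _, by rintro _ ⟨x, rfl⟩; exact hn x⟩, ciSup_le hn⟩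

/-- Energies in a gap between two consecutive local Landau levels lie in the resolvent set, if the
gap is large compared to the gradients. -/
theorem mem_resolventSet_of_gap {A : C(Plane, Plane)} {B V : Plane →ᵇ ℝ}
    (hA : IsVectorPotential A B) (hB : HasBoundedGradient B) (hV : HasBoundedGradient V)
    {b₀ b₁ d s : ℝ} {E : ℝ} {n : ℕ} (hb₀ : 0 < b₀) (hBb₀ : ∀ x, b₀ ≤ B x) (hBb₁ : ∀ x, B x ≤ b₁)
    (hd : 0 < d) (hs : 0 ≤ s) (hsd : d + 2 * (n + 1) * b₁ ≤ s ^ 2 * (2 * b₀))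
    (hlow : ∀ x, (2 * n + 1) * B x + V x ≤ E - d)
    (hup : ∀ x, E + d ≤ (2 * n + 3) * B x + V x)
    (hgrad : 8 * LadderPair.resolventConst s (n + 1) * ((2 * n + 1) * gradSup B + gradSup V)
      ≤ d * √(2 * b₀)) :
    (E : ℂ) ∈ resolventSet (hamiltonian A V) := by
  set L := magneticLadder A B hA with hL
  have hβ : L.β = (2 : ℂ) • potentialCLM B := rfl
  set W := potentialCLM (levelFun B V E 0) with hW
  set M := LadderPair.resolventConst s (n + 1) with hM
  have hM1 : 1 ≤ M := LadderPair.one_le_resolventConst hs _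
  have hWk : ∀ k : ℕ, W + (k : ℂ) • L.β = potentialCLM (levelFun B V E k) := fun k => by
    rw [hβ, hW, potentialCLM_levelFun]
  have hBpos : ∀ x, 0 < B x := fun x => hb₀.trans_le (hBb₀ x)
  have hb₁ : 0 ≤ b₁ := (hBpos 0).le.trans (hBb₁ 0)
  have hkn : ∀ k < n + 1, (k : ℝ) ≤ n := fun k hk => by exact_mod_cast Nat.lt_succ_iff.1 hk
  have hgB := gradSup_nonneg B
  have hgV := gradSup_nonneg V
  set G : ℝ := 2 * ((2 * n + 1) * gradSup B + gradSup V) with hGdef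
  have hG : 0 ≤ G := by positivity
  have key : L.LowerBound W (M / d) := by
    -- Here `β = 2 B ≥ 2 b₀`, and `η = 1 / (4 M)` is the largest value allowed; with it the gradient
    -- hypothesis reads `G ≤ η d √β₀`. The levels below the gap are at least `d - 2 (n + 1) b₁`,
    -- which explains `S`.
    refine LadderPair.lowerBound_of_ladder (β₀ := 2 * b₀) (G := G) (S := 2 * (n + 1) * b₁)
      (η := 1 / (4 * M)) (by linarith) ?_ ?_ hd hG hs (by positivity) hsd (by positivity) ?_
      (n + 1) ?_ W (inner_potentialCLM_symm _) ?_ ?_ ?_ ?_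
    · intro u v
      rw [hβ, smul_apply, smul_apply, inner_smul_left, inner_smul_right, inner_potentialCLM_symm,
        map_ofNat]
    · intro u
      have := le_re_inner_potentialCLM hBb₀ u
      rw [hβ, smul_apply, inner_smul_right]
      simp only [Complex.mul_re, Complex.re_ofNat, Complex.im_ofNat, zero_mul, sub_zero]
      linarith
    · rw [div_mul_eq_mul_div, div_mul_eq_mul_div, le_div_iff₀ (by linarith), one_mul]
      linarith
    · rw [← hM]
      exact (mul_one_div_cancel (by linarith : 4 * M ≠ 0)).le
    · intro k hk
      rw [hWk]
      obtain ⟨h1, h2⟩ := gradSup_levelFun hB hV E k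
      refine commBound_potential hA _ h1 ?_
      have := hkn k hk
      nlinarith
    · intro k hk u
      rw [hWk]
      have := re_inner_potentialCLM_le (V := levelFun B V E k) (m := -d) (fun x => by
        rw [levelFun_apply]
        nlinarith [hlow x, hkn k hk, hBpos x]) u
      linarith
    · intro k hk u
      rw [hWk]
      have hk0 : (0 : ℝ) ≤ k := Nat.cast_nonneg k
      have := le_re_inner_potentialCLM (V := levelFun B V E k) (m := -(2 * (n + 1) * b₁))
        (fun x => by
          rw [levelFun_apply]
          have h1 := hup x
          have h2 : 2 * ((n : ℝ) + 1) * B x ≤ 2 * (n + 1) * b₁ :=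
            mul_le_mul_of_nonneg_left (hBb₁ x) (by positivity)
          nlinarith [hBpos x]) u
      linarith
    · intro u
      rw [hWk]
      refine le_re_inner_potentialCLM (fun x => ?_) u
      rw [levelFun_apply]
      have := hup x
      push_cast
      linarith
  obtain ⟨R, hR, -⟩ := key.exists_resolvent (inner_potentialCLM_symm _)
  refine ⟨R, fun f => ?_, fun ψ => ?_⟩
  · have h1 : L.IsKin (R f)
        (f + (E : ℂ) • R f - potentialCLM B (R f) - potentialCLM V (R f)) := by
      have := hR f
      rw [hW, potentialCLM_levelFun_zero] at this
      convert this using 1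
      abel
    obtain ⟨h, e⟩ := (hamiltonian_iff hA V).2 h1
    exact ⟨h, by rw [e]; abel⟩
  · have h1 := (hamiltonian_iff hA V).1 ⟨ψ.2, rfl⟩
    refine key.unique (hR _) ?_
    rw [hW, potentialCLM_levelFun_zero]
    convert h1 using 1
    abel

/-- The constants in the gap theorem, before symmetrisation in consecutive levels. -/
def gapConst (C₁ : ℝ) (n : ℕ) : ℝ :=
  8 * LadderPair.resolventConst ((2 * n + 3) * C₁) (n + 1) * (2 * n + 1) / √(2 * C₁⁻¹)

theorem gapConst_nonneg {C₁ : ℝ} (hC₁ : 0 < C₁) (n : ℕ) : 0 ≤ gapConst C₁ n := by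
  have := LadderPair.one_le_resolventConst (s := (2 * n + 3) * C₁) (by positivity) (n + 1)
  unfold gapConst
  positivity

end Gap

end

end MagneticSchrodinger

/-! ### The spectral gap theorem. -/

open MagneticSchrodinger in
theorem theorem3p1 (C₁ : ℝ) (hC₁ : 0 < C₁) :
    ∃ Cext : ℕ → ℝ, (∀ n, 0 ≤ Cext n) ∧
      ∀ (B₀ : ℝ) (B₁ B : Plane → ℝ) (V : Plane →ᵇ ℝ) (A : C(Plane, Plane)),
        0 < B₀ →
        (∀ x, B x = B₀ + B₁ x) →
        HasBoundedGradient B₁ →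
        HasBoundedGradient V →
        (∀ x, C₁⁻¹ * B₀ ≤ B x ∧ B x ≤ C₁ * B₀) →
        IsVectorPotential A B →
        ∀ n : ℕ, ∀ E : ℝ,
          E ∈ Set.Ioo (eMax V B n + Cext n * correction B₀ B₁ V)
            (eMin V B (n + 1) - Cext (n + 1) * correction B₀ B₁ V) →
          (E : ℂ) ∈ MagneticSchrodinger.resolventSet (hamiltonian A V) := by
  -- The gap above level `n` needs `gapConst C₁ n` at both ends, that is, in the constants of index
  -- `n` and of index `n + 1`. At `n = 0` the truncated `n - 1 = 0` only enlarges the constant.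
  refine ⟨fun n => gapConst C₁ n + gapConst C₁ (n - 1),
    fun n => add_nonneg (gapConst_nonneg hC₁ _) (gapConst_nonneg hC₁ _), ?_⟩
  intro B₀ B₁ B V A hB₀ hBB₁ hB₁ hV hBC hA n E hE
  have hBfun : B = fun x => B₀ + B₁ x := funext hBB₁
  have hfd : ∀ x, fderiv ℝ B x = fderiv ℝ B₁ x := fun x => by
    rw [hBfun, fderiv_const_add]
  have hBd : Differentiable ℝ B := by
    rw [hBfun]
    exact (differentiable_const _).add hB₁.1
  have hBg : HasBoundedGradient B := ⟨hBd, by simpa only [hfd] using hB₁.2⟩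
  have hgrad : gradSup B = gradSup B₁ := by simp only [gradSup, hfd]
  have hb₀ : 0 < C₁⁻¹ * B₀ := by positivity
  have hBpos : ∀ x, 0 < B x := fun x => hb₀.trans_le (hBC x).1
  set Bb : Plane →ᵇ ℝ := fieldBCF B hBd.continuous (C₁ * B₀) (fun x => by
    rw [Real.norm_of_nonneg (hBpos x).le]; exact (hBC x).2) with hBb
  have hVb : ∀ x, |V x| ≤ ‖V‖ := V.norm_coe_le_norm
  have hmax : ∀ x, (2 * n + 1) * B x + V x ≤ eMax V B n := by
    refine le_ciSup (f := fun x => (2 * (n : ℝ) + 1) * B x + V x)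
      ⟨(2 * n + 1) * (C₁ * B₀) + ‖V‖, ?_⟩
    rintro _ ⟨x, rfl⟩
    exact add_le_add (mul_le_mul_of_nonneg_left (hBC x).2 (by positivity))
      ((le_abs_self _).trans (hVb x))
  have hmin : ∀ x, eMin V B (n + 1) ≤ (2 * n + 3) * B x + V x := by
    intro x
    have h := ciInf_le (f := fun x => (2 * ((n + 1 : ℕ) : ℝ) + 1) * B x + V x) ⟨-‖V‖, by
      rintro _ ⟨y, rfl⟩
      have h1 := (abs_le.1 (hVb y)).1
      have h2 : 0 ≤ (2 * ((n + 1 : ℕ) : ℝ) + 1) * B y :=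
        mul_nonneg (by positivity) (hBpos y).le
      simp only
      linarith⟩ x
    refine h.trans (le_of_eq ?_)
    push_cast
    ring
  set κ := correction B₀ B₁ V with hκ
  have hK2 : 0 ≤ K2 B₁ V := add_nonneg (gradSup_nonneg _) (gradSup_nonneg _)
  -- The `K̂₂` term alone suffices for the gap condition; the `K̂₃` term is nonnegative.
  have hκK : K2 B₁ V * B₀ ^ (-(1 / 2) : ℝ) ≤ κ := by
    have : 0 ≤ K3 B₁ * B₀ ^ (-2 : ℝ) := mul_nonneg (sq_nonneg _) (Real.rpow_nonneg hB₀.le _)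
    rw [hκ, correction]
    linarith
  have hκ0 : 0 ≤ κ := (mul_nonneg hK2 (Real.rpow_nonneg hB₀.le _)).trans hκK
  have hD := gapConst_nonneg hC₁
  obtain ⟨hE1, hE2⟩ := hE
  simp only [Nat.add_sub_cancel] at hE1 hE2
  set D := gapConst C₁ n with hDdef
  have hlo : eMax V B n + D * κ < E := by nlinarith [mul_nonneg (hD (n - 1)) hκ0]
  have hhi : E < eMin V B (n + 1) - D * κ := by nlinarith [mul_nonneg (hD (n + 1)) hκ0]
  set d := min (E - eMax V B n) (eMin V B (n + 1) - E) with hd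
  have hDκ : 0 ≤ D * κ := mul_nonneg (hD n) hκ0
  have hd0 : 0 < d := lt_min (by linarith) (by linarith)
  have hdκ : D * κ ≤ d := le_min (by linarith) (by linarith)
  have hd1 : d ≤ E - eMax V B n := min_le_left _ _
  have hd2 : d ≤ eMin V B (n + 1) - E := min_le_right _ _
  refine mem_resolventSet_of_gap (B := Bb) (b₀ := C₁⁻¹ * B₀) (b₁ := C₁ * B₀) (d := d)
    (s := (2 * n + 3) * C₁) (n := n) hA hBg hV hb₀ (fun x => (hBC x).1) (fun x => (hBC x).2) hd0
    (by positivity) ?_ (fun x => ?_) (fun x => ?_) ?_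
  -- Adding the two bounds on `d` at one point gives `2 d ≤ 2 B ≤ 2 C₁ B₀`. So `d + 2 (n + 1) C₁ B₀`
  -- is at most `2 (2n + 3)² C₁ B₀`, the value produced by `s = (2n + 3) C₁`.
  · have h1 := hmax 0
    have h2 := hmin 0
    have h3 := (hBC 0).2
    have h4 : d ≤ C₁ * B₀ := by linarith
    have h5 : ((2 * (n : ℝ) + 3) * C₁) ^ 2 * (2 * (C₁⁻¹ * B₀))
        = 2 * (2 * n + 3) ^ 2 * (C₁ * B₀) := by
      field_simp
    rw [h5]
    have h6 : 0 < C₁ * B₀ := by positivity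
    have h7 : (0 : ℝ) ≤ n := Nat.cast_nonneg n
    nlinarith [mul_nonneg h7 h6.le, mul_nonneg (mul_nonneg h7 h7) h6.le]
  · have := hmax x
    change (2 * n + 1) * B x + V x ≤ E - d
    linarith
  · have := hmin x
    change E + d ≤ (2 * n + 3) * B x + V x
    linarith
  · change 8 * LadderPair.resolventConst ((2 * n + 3) * C₁) (n + 1)
      * ((2 * n + 1) * gradSup B + gradSup V) ≤ d * √(2 * (C₁⁻¹ * B₀))
    rw [hgrad]
    set M := LadderPair.resolventConst ((2 * n + 3) * C₁) (n + 1) with hM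
    have hM1 : 1 ≤ M := LadderPair.one_le_resolventConst (by positivity) _
    set r := √(2 * C₁⁻¹) with hr
    have hr0 : 0 < r := Real.sqrt_pos.2 (by positivity)
    -- This `√B₀` cancels the power `B₀^(-1/2)` in the correction, so the final constant depends on
    -- `n` and `C₁` only.
    have hsq : √(2 * (C₁⁻¹ * B₀)) = r * √B₀ := by
      rw [← mul_assoc, Real.sqrt_mul (by positivity)]
    have hpow : B₀ ^ (-(1 / 2) : ℝ) * √B₀ = 1 := by
      rw [Real.sqrt_eq_rpow, ← Real.rpow_add hB₀]
      simp
    have hDr : D * r = 8 * M * (2 * n + 1) := by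
      rw [hDdef, gapConst, div_mul_cancel₀ _ hr0.ne']
    have h1 : (2 * n + 1) * gradSup B₁ + gradSup V ≤ (2 * n + 1) * K2 B₁ V := by
      have := gradSup_nonneg V
      have h7 : (0 : ℝ) ≤ n := Nat.cast_nonneg n
      rw [K2]
      nlinarith [mul_nonneg h7 this]
    calc 8 * M * ((2 * n + 1) * gradSup B₁ + gradSup V)
        ≤ 8 * M * ((2 * n + 1) * K2 B₁ V) := by gcongr
      _ = (D * r) * K2 B₁ V := by rw [hDr]; ring
      _ = D * (K2 B₁ V * B₀ ^ (-(1 / 2) : ℝ)) * (r * √B₀) := by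
          linear_combination (-(D * r * K2 B₁ V)) * hpow
      _ ≤ D * κ * (r * √B₀) := by
          have := hD n
          gcongr
      _ ≤ d * (r * √B₀) := by gcongr
      _ = _ := by rw [hsq]
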